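/- Let $d\ge 0$ be an integer. For $n\ge 0$ and $m\in\mathbb Z$ let $\mathcal H_{n,m}$ be the group of homogeneous symmetric polynomials with integer coefficients in $n$ variables, of degree $k$, where $m=2k+(1-d)n^2$ (and $\mathcal H_{n,m}=0$ if no integer $k\ge 0$ satisfies this); these are the bigraded pieces of the Cohomological Hall algebra of the quiver with one vertex and $d$ loops. Let $$P_d=\sum_{n\ge 0,\,m\in\mathbb Z}(-1)^m\operatorname{rank}(\mathcal H_{n,m})\,z^nq^{m/2}\in\mathbb Z((q^{1/2}))[[z]]$$ be its Hilbert–Poincaré series twisted by the sign. Then $$P_d=\sum_{n\ge 0}\frac{(-q^{1/2})^{(1-d)n^2}}{(1-q)(1-q^2)\cdots(1-q^n)}\,z^n ,$$ and there exist integers $\delta^{(d)}(n,m)$ for all $n\ge 1$ and all $m\in(d-1)n+2\mathbb Z=(1-d)n^2+2\mathbb Z$ (with $\delta^{(d)}(n,m):=0$ for the other $m\in\mathbb Z$) such that for each given $n$ one has $\delta^{(d)}(n,m)\neq 0$ for only finitely many $m$, and $$P_d=\prod_{n\ge 1}\prod_{m\in\mathbb Z}\left(q^{m/2}z^n;q\right)_\infty^{\delta^{(d)}(n,m)},$$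 where $(x;q)_\infty=\prod_{i\ge 0}(1-q^ix)$. The infinite products converge in $\mathbb Z((q^{1/2}))[[z]]$, coefficientwise in $z$ for the $q^{1/2}$-adic topology, and the series $(q^{m/2}z^n;q)_\infty$ with $n\ge 1$ are invertible in this ring. -/

import Mathlib

open scoped PowerSeries.WithPiTopology

/-- The bigraded piece `H_{n,m}` for the quiver with one vertex and `d` loops: symmetric polynomials
in `n` variables with integer coefficients all of whose monomials have degree `k` with
`2 k + (1 - d) n ^ 2 = m` (so it is zero if no such `k ≥ 0` exists). -/
def cohaPiece (d n : ℕ) (m : ℤ) : Submodule ℤ (MvPolynomial (Fin n) ℤ) where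
  carrier := {f | f.IsSymmetric ∧
    ∀ s ∈ f.support, 2 * (s.degree : ℤ) + (1 - (d : ℤ)) * (n : ℤ) ^ 2 = m}
  add_mem' := by
    classical
    rintro f g ⟨hf, hf'⟩ ⟨hg, hg'⟩
    refine ⟨hf.add hg, fun s hs => ?_⟩
    rcases Finset.mem_union.1 (MvPolynomial.support_add hs) with h | h
    · exact hf' s h
    · exact hg' s h
  zero_mem' := ⟨MvPolynomial.IsSymmetric.zero, by simp⟩
  smul_mem' := by
    rintro c f ⟨hf, hf'⟩
    exact ⟨hf.smul c, fun s hs => hf' s (MvPolynomial.support_smul hs)⟩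

theorem cohaPiece_eq_bot {d n : ℕ} {m : ℤ} (h : m < (1 - (d : ℤ)) * (n : ℤ) ^ 2) :
    cohaPiece d n m = ⊥ := by
  rw [eq_bot_iff]
  rintro f ⟨-, hf⟩
  rw [Submodule.mem_bot, ← MvPolynomial.support_eq_empty, Finset.eq_empty_iff_forall_notMem]
  intro s hs
  have := hf s hs
  omega

/-- The coefficient of `z ^ n` in the sign-twisted Hilbert–Poincaré series, the Laurent series
`∑ m, (-1) ^ m * rank H_{n,m} * t ^ m` in the variable `t = q^{1/2}`. -/
noncomputable def hilbertCoeff (d n : ℕ) : LaurentSeries ℤ :=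
  HahnSeries.ofSuppBddBelow
    (fun m : ℤ => (m.negOnePow : ℤ) * (Module.finrank ℤ (cohaPiece d n m) : ℤ))
    ⟨(1 - (d : ℤ)) * (n : ℤ) ^ 2, fun m hm => by
      by_contra h
      apply hm
      have h0 : Module.finrank ℤ (cohaPiece d n m) = 0 := by
        rw [cohaPiece_eq_bot (not_le.1 h)]
        exact finrank_bot ℤ _
      simp [h0]⟩

/-- The sign-twisted Hilbert–Poincaré series `P_d ∈ ℤ((q^{1/2}))[[z]]`. -/
noncomputable def hilbertSeries (d : ℕ) : PowerSeries (LaurentSeries ℤ) :=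
  PowerSeries.mk (hilbertCoeff d)

/-- The monomial `q^{m/2}` of `ℤ((q^{1/2}))`. -/
noncomputable def qHalfPow (m : ℤ) : LaurentSeries ℤ := HahnSeries.single m 1

/-- The `q^{1/2}`-adic topology of `ℤ((q^{1/2}))`: the sets of all series that agree with a given
one in all degrees below some `k` form a basis. The ring `ℤ((q^{1/2}))[[z]]` carries the topology of
convergence of each coefficient in this topology. -/
instance laurentTopology : TopologicalSpace (LaurentSeries ℤ) where
  IsOpen U := ∀ f ∈ U, ∃ k : ℤ, ∀ g : LaurentSeries ℤ,
    (∀ m < k, g.coeff m = f.coeff m) → g ∈ U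
  isOpen_univ := fun _ _ => ⟨0, fun _ _ => trivial⟩
  isOpen_inter := by
    rintro U V hU hV f ⟨hfU, hfV⟩
    obtain ⟨k, hk⟩ := hU f hfU
    obtain ⟨l, hl⟩ := hV f hfV
    exact ⟨max k l, fun g hg => ⟨hk g fun m hm => hg m (lt_max_of_lt_left hm),
      hl g fun m hm => hg m (lt_max_of_lt_right hm)⟩⟩
  isOpen_sUnion := by
    rintro S hS f ⟨U, hU, hf⟩
    obtain ⟨k, hk⟩ := hS U hU f hf
    exact ⟨k, fun g hg => ⟨U, hU, hk g hg⟩⟩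

/-- The `i`-th factor `1 - q ^ i x` of the `q`-Pochhammer symbol. -/
noncomputable def qPochhammerFactor (x : PowerSeries (LaurentSeries ℤ)) (i : ℕ) :
    PowerSeries (LaurentSeries ℤ) :=
  1 - PowerSeries.C (qHalfPow 2 ^ i) * x

/-- The `q`-Pochhammer symbol `(x; q)_∞ = ∏_{i ≥ 0} (1 - q ^ i x)`. -/
noncomputable def qPochhammerInf (x : PowerSeries (LaurentSeries ℤ)) :
    PowerSeries (LaurentSeries ℤ) :=
  ∏' i : ℕ, qPochhammerFactor x i

/-- The monomial `q^{m/2} z^n`. -/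
noncomputable def qzMonomial (n : ℕ) (m : ℤ) : PowerSeries (LaurentSeries ℤ) :=
  PowerSeries.monomial n (qHalfPow m)

/-- The integer power `F ^ e` of an invertible series `F`. -/
noncomputable def seriesZPow (F : PowerSeries (LaurentSeries ℤ)) :
    ℤ → PowerSeries (LaurentSeries ℤ)
  | Int.ofNat k => F ^ k
  | Int.negSucc k => Ring.inverse F ^ (k + 1)

/-! Write t = q^{1/2}, e = 1 - d and P(z) for the series. Symmetric polynomials form a polynomial
ring on the elementary ones; this gives the closed form, and with it the q-difference equation P(z)
= P(qz) + (-t)^e z P(q^e z).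

The exponents are found degree by degree. If F = 1 + a z^n + ⋯, then ∏_m (t^m z^n; q)_∞^{f_m} has
the same leading term once f = ∑ f_m t^m equals a (q - 1). So a (q - 1) must be a Laurent polynomial
at every stage, which calls for a property of P that survives division by Pochhammer symbols. This
is `admissible`: the ratio G(z) = F(qz) / F(z) has Laurent polynomial coefficients, and ∏_{i<N}
G(ζ^i z; t) = G(z^N; t^N) whenever ζ = t² is a primitive N-th root of unity. The coefficient of z^n
in G is b = (q^n - 1) a. For N ∣ n, N > 1, the identity in degree n says N b(t) = 0, so (q^n - 1) /
(q - 1) divides b and a (q - 1) is a Laurent polynomial (`exists_laurentIncl_eq`).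

That P is admissible is seen on the ratios ρ_i = P(q^i z) / P(z), which satisfy ρ_i = ρ_{i+1} +
(-t)^e q^i z ρ_{i+e}. Telescoping from ρ_0 = 1 gives Laurent polynomial coefficients. At a root of
unity the two operators on the right q-commute, so the N-th power of their sum is the sum of their
N-th powers; hence ρ_N solves 1 = w + (-t^N)^e z^N w^e. So does ρ_1(z^N; t^N), and the solution is
unique (`rootNorm_eq_powerTwist_of_cocycle`).

The parity of m comes from invariance under t ↦ -t, z ↦ (-1)^(d-1) z, which is also preserved at
every stage. -/

/-! ### Graded pieces in terms of elementary symmetric polynomials -/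

namespace MvPolynomial

theorem IsWeightedHomogeneous.aeval {σ τ R M : Type*} [CommSemiring R] [AddCommMonoid M]
    {w : σ → M} {w' : τ → M} {f : σ → MvPolynomial τ R}
    (hf : ∀ i, (f i).IsWeightedHomogeneous w' (w i)) {p : MvPolynomial σ R} {m : M}
    (hp : p.IsWeightedHomogeneous w m) : (MvPolynomial.aeval f p).IsWeightedHomogeneous w' m := by
  rw [aeval_def, eval₂_eq]
  refine IsWeightedHomogeneous.sum _ _ _ fun s hs => ?_
  rw [← hp (mem_support_iff.1 hs)]
  refine IsWeightedHomogeneous.C_mul ?_ _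
  rw [Finsupp.weight_apply, Finsupp.sum]
  exact IsWeightedHomogeneous.prod _ _ _ fun i _ => (hf i).pow _

/-- The substitution commutes with taking components of a given weight, so projecting to weight m
fixes the image of p, and injectivity pulls this back to p. -/
theorem isWeightedHomogeneous_of_aeval {σ τ R M : Type*} [CommSemiring R] [AddCommMonoid M]
    {w : σ → M} {w' : τ → M} {f : σ → MvPolynomial τ R}
    (hf : ∀ i, (f i).IsWeightedHomogeneous w' (w i))
    (hinj : Function.Injective (MvPolynomial.aeval (R := R) f)) {p : MvPolynomial σ R} {m : M}
    (hp : (MvPolynomial.aeval f p).IsWeightedHomogeneous w' m) : p.IsWeightedHomogeneous w m := by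
  classical
  have key : weightedHomogeneousComponent w m p = p := by
    apply hinj
    have h := congrArg (fun g => weightedHomogeneousComponent w' m (MvPolynomial.aeval f g))
      (finsum_weightedHomogeneousComponent w p)
    simp only [hp.weightedHomogeneousComponent_same] at h
    rw [← h, finsum_eq_sum _ (weightedHomogeneousComponent_finsupp p), map_sum, map_sum]
    have hk : ∀ k, weightedHomogeneousComponent w' m
        (MvPolynomial.aeval f (weightedHomogeneousComponent w k p)) =
        if k = m then MvPolynomial.aeval f (weightedHomogeneousComponent w k p) else 0 := by
      intro k
      have hk := IsWeightedHomogeneous.aeval hf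
        (weightedHomogeneousComponent_isWeightedHomogeneous (w := w) k p)
      split_ifs with h
      · subst h; exact hk.weightedHomogeneousComponent_same
      · exact hk.weightedHomogeneousComponent_ne _ (Ne.symm h)
    simp only [hk, Finset.sum_ite_eq']
    split_ifs with h'
    · rfl
    · have h0 : weightedHomogeneousComponent w m p = 0 := by
        by_contra h0
        exact h' ((Set.Finite.mem_toFinset _).2 h0)
      rw [h0, map_zero]
  rw [← key]
  exact weightedHomogeneousComponent_isWeightedHomogeneous m p

theorem isWeightedHomogeneous_esymm (n k : ℕ) :
    (esymm (Fin n) ℤ k).IsWeightedHomogeneous (fun _ => (2 : ℤ)) (2 * (k : ℤ)) := by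
  refine IsWeightedHomogeneous.sum _ _ _ fun s hs => ?_
  have := IsWeightedHomogeneous.prod (R := ℤ) s (fun i => X i) (fun _ => (2 : ℤ))
    (w := fun _ : Fin n => (2 : ℤ)) fun i _ => isWeightedHomogeneous_X _ _ i
  rwa [Finset.sum_const, (Finset.mem_powersetCard.1 hs).2, nsmul_eq_mul, mul_comm] at this

end MvPolynomial

-- Graded form of the fundamental theorem on symmetric polynomials. Variables are counted from 0,
-- and degrees in powers of q^{1/2}; hence the weight 2 (i + 1).
open MvPolynomial in
theorem cohaPiece_eq_map (d n : ℕ) (m : ℤ) :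
    cohaPiece d n m = (weightedHomogeneousSubmodule ℤ (fun i : Fin n => 2 * ((i : ℤ) + 1))
      (m - (1 - (d : ℤ)) * (n : ℤ) ^ 2)).map
      (MvPolynomial.aeval fun i : Fin n => esymm (Fin n) ℤ (i + 1)).toLinearMap := by
  have hf : ∀ i : Fin n, (esymm (Fin n) ℤ (i + 1)).IsWeightedHomogeneous (fun _ => (2 : ℤ))
      (2 * ((i : ℤ) + 1)) := fun i => by exact_mod_cast isWeightedHomogeneous_esymm n (i + 1)
  have hval : ∀ p, ((esymmAlgHom (Fin n) ℤ n p : symmetricSubalgebra (Fin n) ℤ) :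
      MvPolynomial (Fin n) ℤ) = MvPolynomial.aeval (fun i : Fin n => esymm (Fin n) ℤ (i + 1)) p :=
    fun p => esymmAlgHom_apply p
  have hinj : Function.Injective
      (MvPolynomial.aeval (R := ℤ) fun i : Fin n => esymm (Fin n) ℤ (i + 1)) := by
    intro p p' h
    apply esymmAlgHom_fin_injective ℤ le_rfl
    apply Subtype.ext
    rw [hval, hval, h]
  have hmem : ∀ f : MvPolynomial (Fin n) ℤ,
      (∀ s ∈ f.support, 2 * (s.degree : ℤ) + (1 - (d : ℤ)) * (n : ℤ) ^ 2 = m) ↔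
      f.IsWeightedHomogeneous (fun _ => (2 : ℤ)) (m - (1 - (d : ℤ)) * (n : ℤ) ^ 2) := by
    intro f
    refine forall_congr' fun s => ?_
    rw [mem_support_iff]
    refine imp_congr_right fun _ => ?_
    have : Finsupp.weight (fun _ : Fin n => (2 : ℤ)) s = 2 * (s.degree : ℤ) := by
      rw [Finsupp.weight_apply, Finsupp.sum, Finsupp.degree_apply, Nat.cast_sum, Finset.mul_sum]
      exact Finset.sum_congr rfl fun i _ => by rw [nsmul_eq_mul, mul_comm]
    rw [this]
    omega
  ext f
  rw [Submodule.mem_map]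
  constructor
  · rintro ⟨hs, hd⟩
    obtain ⟨p, hp⟩ := esymmAlgHom_fin_surjective ℤ le_rfl ⟨f, hs⟩
    have hp' := congrArg Subtype.val hp
    rw [hval] at hp'
    refine ⟨p, isWeightedHomogeneous_of_aeval hf hinj ?_, hp'⟩
    rw [hp']
    exact (hmem f).1 hd
  · rintro ⟨p, hp, rfl⟩
    refine ⟨?_, (hmem _).2 (IsWeightedHomogeneous.aeval hf hp)⟩
    have := (esymmAlgHom (Fin n) ℤ n p).2
    rwa [hval] at this

open MvPolynomial in
theorem finrank_cohaPiece (d n : ℕ) (m : ℤ) :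
    Module.finrank ℤ (cohaPiece d n m) = Nat.card {a : Fin n →₀ ℕ //
      Finsupp.weight (fun i : Fin n => 2 * ((i : ℤ) + 1)) a =
        m - (1 - (d : ℤ)) * (n : ℤ) ^ 2} := by
  have hinj : Function.Injective
      (MvPolynomial.aeval (R := ℤ) fun i : Fin n => esymm (Fin n) ℤ (i + 1)) := by
    intro p p' h
    apply esymmAlgHom_fin_injective ℤ le_rfl
    apply Subtype.ext
    exact (esymmAlgHom_apply p).trans (h.trans (esymmAlgHom_apply p').symm)
  rw [cohaPiece_eq_map, ← (Submodule.equivMapOfInjective _ hinj _).finrank_eq,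
    weightedHomogeneousSubmodule_eq_finsupp_supported,
    (AddMonoidAlgebra.supportedEquivFinsupp _).finrank_eq,
    Module.finrank_eq_nat_card_basis Finsupp.basisSingleOne]
  rfl

/-! ### Generating functions and the closed form -/

namespace PowerSeries

theorem mk_dvd_mul_one_sub_X_pow {v : ℕ} (hv : 0 < v) :
    (mk fun k => if v ∣ k then (1 : ℤ) else 0) * (1 - X ^ v) = 1 := by
  ext k
  rw [mul_sub, mul_one, map_sub, coeff_mul_X_pow', coeff_mk, coeff_one]
  rcases Nat.lt_or_ge k v with h | h
  · rw [if_neg (Nat.not_le.2 h), sub_zero]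
    refine if_congr ⟨fun hd => Nat.eq_zero_of_dvd_of_lt hd h, ?_⟩ rfl rfl
    rintro rfl
    exact dvd_zero v
  · rw [if_pos h, coeff_mk, if_neg (by omega : k ≠ 0), sub_eq_zero]
    refine if_congr ⟨fun hd => Nat.dvd_sub hd dvd_rfl, fun hd => ?_⟩ rfl rfl
    simpa [Nat.sub_add_cancel h] using dvd_add hd (dvd_refl v)

/-- The count is the coefficient of a product of geometric series: a ↦ (v i * a i) is a bijection
onto the decompositions of k into multiples of the v i. -/
theorem mk_card_mul_prod {n : ℕ} {v : Fin n → ℕ} (hv : ∀ i, 0 < v i) :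
    (mk fun k => (Nat.card {a : Fin n →₀ ℕ // ∑ i, v i * a i = k} : ℤ)) *
      ∏ i, (1 - X ^ v i) = 1 := by
  have : (mk fun k => (Nat.card {a : Fin n →₀ ℕ // ∑ i, v i * a i = k} : ℤ)) =
      ∏ i, mk fun k => if v i ∣ k then (1 : ℤ) else 0 := by
    ext k
    simp only [coeff_prod, coeff_mk, Finset.prod_ite_zero, Finset.prod_const_one]
    rw [← Finset.natCast_card_filter]
    congr 1
    rw [← Nat.card_eq_finsetCard]
    refine Nat.card_eq_of_bijective (fun a => ⟨Finsupp.equivFunOnFinite.symm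
      fun i => v i * a.1 i, ?_⟩) ⟨fun a b hab => ?_, fun b => ?_⟩
    · simp [a.2]
    · refine Subtype.ext (Finsupp.ext fun i => ?_)
      have := DFunLike.congr_fun (congrArg Subtype.val hab) i
      exact Nat.eq_of_mul_eq_mul_left (hv i) this
    · obtain ⟨b, hb⟩ := b
      simp only [Finset.mem_filter, Finset.mem_finsuppAntidiag, Finset.mem_univ, true_imp_iff]
        at hb
      have hd : ∀ i, v i * (b i / v i) = b i := fun i => Nat.mul_div_cancel' (hb.2 i)
      refine ⟨⟨Finsupp.equivFunOnFinite.symm fun i => b i / v i, ?_⟩, ?_⟩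
      · simpa [hd] using hb.1.1
      · exact Subtype.ext (Finsupp.ext fun i => by simp [hd])
  rw [this, ← Finset.prod_mul_distrib]
  exact Finset.prod_eq_one fun i _ => mk_dvd_mul_one_sub_X_pow (hv i)

end PowerSeries

theorem hilbertCoeff_eq (d n : ℕ) : hilbertCoeff d n =
    HahnSeries.single ((1 - (d : ℤ)) * (n : ℤ) ^ 2)
        ((((1 - (d : ℤ)) * (n : ℤ) ^ 2).negOnePow : ℤˣ) : ℤ) *
      HahnSeries.ofPowerSeries ℤ ℤ (PowerSeries.mk fun k =>
        (Nat.card {a : Fin n →₀ ℕ // ∑ i : Fin n, (2 * (i + 1) : ℕ) * a i = k} : ℤ)) := by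
  ext m
  set c := (1 - (d : ℤ)) * (n : ℤ) ^ 2 with hc
  rw [HahnSeries.coeff_single_mul, PowerSeries.coeff_coe]
  change (m.negOnePow : ℤ) * (Module.finrank ℤ (cohaPiece d n m) : ℤ) = _
  rw [finrank_cohaPiece, ← hc]
  have hw : ∀ a : Fin n →₀ ℕ, Finsupp.weight (fun i : Fin n => 2 * ((i : ℤ) + 1)) a =
      ((∑ i : Fin n, (2 * (i + 1) : ℕ) * a i : ℕ) : ℤ) := by
    intro a
    rw [Finsupp.weight_apply, Finsupp.sum_fintype _ _ (by simp)]
    push_cast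
    exact Finset.sum_congr rfl fun i _ => by rw [nsmul_eq_mul, mul_comm]
  simp only [hw]
  split_ifs with h
  · have : IsEmpty {a : Fin n →₀ ℕ //
        ((∑ i : Fin n, (2 * (i + 1) : ℕ) * a i : ℕ) : ℤ) = m - c} :=
      ⟨fun a => by have := a.2; omega⟩
    rw [Nat.card_of_isEmpty, Nat.cast_zero, mul_zero, mul_zero]
  · obtain ⟨k, hk⟩ := Int.eq_ofNat_of_zero_le (not_lt.1 h)
    rw [hk, Int.natAbs_natCast, PowerSeries.coeff_mk]
    simp only [Nat.cast_inj]
    rcases isEmpty_or_nonempty {a : Fin n →₀ ℕ // ∑ i : Fin n, (2 * (i + 1) : ℕ) * a i = k}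
      with h0 | ⟨⟨a, ha⟩⟩
    · simp
    -- All degrees that occur have the parity of c, so the sign is constant.
    · have he : m = c + 2 * ∑ i : Fin n, (((i : ℕ) : ℤ) + 1) * a i := by
        have : (k : ℤ) = 2 * ∑ i : Fin n, (((i : ℕ) : ℤ) + 1) * a i := by
          rw [← ha, Finset.mul_sum]; push_cast; exact Finset.sum_congr rfl fun i _ => by ring
        omega
      congr 2
      rw [he, Int.negOnePow_add, Int.negOnePow_two_mul, mul_one]

theorem qHalfPow_two_pow (i : ℕ) : qHalfPow 2 ^ i = qHalfPow (2 * i) := by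
  rw [qHalfPow, HahnSeries.single_pow, one_pow, nsmul_eq_mul, mul_comm, qHalfPow]

theorem ofPowerSeries_X_pow_eq_qHalfPow (k : ℕ) :
    HahnSeries.ofPowerSeries ℤ ℤ (PowerSeries.X ^ k) = qHalfPow k := by
  rw [HahnSeries.ofPowerSeries_X_pow, qHalfPow]

theorem hilbertCoeff_mul_prod (d n : ℕ) :
    hilbertCoeff d n * ∏ i ∈ Finset.Icc 1 n, (1 - qHalfPow 2 ^ i) =
      HahnSeries.single ((1 - (d : ℤ)) * (n : ℤ) ^ 2)
        ((((1 - (d : ℤ)) * (n : ℤ) ^ 2).negOnePow : ℤˣ) : ℤ) := by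
  have h := congrArg (HahnSeries.ofPowerSeries ℤ ℤ)
    (PowerSeries.mk_card_mul_prod (v := fun i : Fin n => 2 * (i + 1)) fun i => by positivity)
  rw [map_mul, map_prod, map_one] at h
  have hp : ∏ i ∈ Finset.Icc 1 n, (1 - qHalfPow 2 ^ i) =
      ∏ i : Fin n, HahnSeries.ofPowerSeries ℤ ℤ (1 - PowerSeries.X ^ (2 * ((i : ℕ) + 1))) := by
    rw [Fin.prod_univ_eq_prod_range (fun i : ℕ => HahnSeries.ofPowerSeries ℤ ℤ
      (1 - PowerSeries.X ^ (2 * (i + 1)))) n, Finset.range_eq_Ico,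
      Finset.prod_Ico_add' (fun i : ℕ => HahnSeries.ofPowerSeries ℤ ℤ
      (1 - PowerSeries.X ^ (2 * i))) 0 n 1]
    refine Finset.prod_congr (by ext; simp) fun i _ => ?_
    rw [map_sub, map_one, ofPowerSeries_X_pow_eq_qHalfPow, qHalfPow_two_pow]
    push_cast
    rfl
  rw [hilbertCoeff_eq, hp, mul_assoc, h, mul_one]

/-! ### Convergence in the q^{1/2}-adic topology -/

open Filter Topology in
theorem tendsto_laurentSeries {ι : Type*} {l : Filter ι} {u : ι → LaurentSeries ℤ}
    {f : LaurentSeries ℤ} (h : ∀ k : ℤ, ∀ᶠ i in l, ∀ m < k, (u i).coeff m = f.coeff m) :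
    Tendsto u l (𝓝 f) := by
  rw [tendsto_nhds]
  intro U hU hf
  obtain ⟨k, hk⟩ := hU f hf
  exact (h k).mono fun i hi => hk _ hi

theorem isOpen_laurentSeries_agree (f : LaurentSeries ℤ) (k : ℤ) :
    IsOpen {g : LaurentSeries ℤ | ∀ m < k, g.coeff m = f.coeff m} :=
  fun _ hg => ⟨k, fun _ hg' m hm => (hg' m hm).trans (hg m hm)⟩

/-- Uniqueness of limits identifies `∏'` with any limit that has been exhibited. -/
instance laurentSeries_t2Space : T2Space (LaurentSeries ℤ) where
  t2 f g hfg := by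
    have : ∃ m, f.coeff m ≠ g.coeff m := by
      by_contra! h
      exact hfg (HahnSeries.ext (funext h))
    obtain ⟨m, hm⟩ := this
    refine ⟨_, _, isOpen_laurentSeries_agree f (m + 1), isOpen_laurentSeries_agree g (m + 1),
      fun _ _ => rfl, fun _ _ => rfl, ?_⟩
    rw [Set.disjoint_left]
    intro x hx hx'
    exact hm ((hx m (by omega)).symm.trans (hx' m (by omega)))

theorem qHalfPow_add (a b : ℤ) : qHalfPow (a + b) = qHalfPow a * qHalfPow b := by
  rw [qHalfPow, qHalfPow, qHalfPow, HahnSeries.single_mul_single, one_mul]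

theorem qHalfPow_zero : qHalfPow 0 = 1 := rfl

theorem qHalfPow_pow (a : ℤ) (k : ℕ) : qHalfPow a ^ k = qHalfPow (k * a) := by
  rw [qHalfPow, HahnSeries.single_pow, one_pow, nsmul_eq_mul, qHalfPow]

/-! ### Euler's series and the Pochhammer symbols -/

/-- The coefficients of `(y; t ^ 2)_∞` as a power series in `y` over `ℤ⟦t⟧`. -/
noncomputable def eulerCoeff : ℕ → PowerSeries ℤ
  | 0 => 1
  | k + 1 => -(PowerSeries.X ^ 2) ^ k * eulerCoeff k *
      PowerSeries.invOfUnit (1 - (PowerSeries.X ^ 2) ^ (k + 1)) 1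

/-- The series `(y; t ^ 2)_∞` in `ℤ⟦t⟧⟦y⟧`. -/
noncomputable def eulerSeries : PowerSeries (PowerSeries ℤ) := PowerSeries.mk eulerCoeff

theorem eulerCoeff_succ_mul (k : ℕ) :
    eulerCoeff (k + 1) * (1 - (PowerSeries.X ^ 2) ^ (k + 1)) =
      -(PowerSeries.X ^ 2) ^ k * eulerCoeff k := by
  rw [eulerCoeff, mul_assoc, mul_comm (PowerSeries.invOfUnit _ _), PowerSeries.mul_invOfUnit,
    mul_one]
  simp

theorem eulerSeries_eq : eulerSeries = (1 - PowerSeries.X) *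
    PowerSeries.rescale (PowerSeries.X ^ 2) eulerSeries := by
  ext1 k
  rw [sub_mul, one_mul, map_sub, PowerSeries.coeff_rescale]
  cases k with
  | zero => simp
  | succ k =>
    rw [PowerSeries.coeff_succ_X_mul, PowerSeries.coeff_rescale]
    simp only [eulerSeries, PowerSeries.coeff_mk]
    linear_combination eulerCoeff_succ_mul k

theorem eulerSeries_eq_prod_mul (M : ℕ) : eulerSeries =
    (∏ i ∈ Finset.range M, (1 - PowerSeries.C ((PowerSeries.X ^ 2) ^ i) * PowerSeries.X)) *
    PowerSeries.rescale ((PowerSeries.X ^ 2) ^ M) eulerSeries := by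
  induction M with
  | zero => simp
  | succ M ih =>
    rw [Finset.prod_range_succ, mul_assoc]
    conv_lhs => rw [ih]
    congr 1
    conv_lhs => rw [eulerSeries_eq]
    rw [map_mul, map_sub, map_one, PowerSeries.rescale_X, PowerSeries.rescale_rescale, ← pow_succ']

theorem C_dvd_rescale_sub_one {A : Type*} [CommRing A] (a : A) {f : PowerSeries A}
    (hf : PowerSeries.constantCoeff f = 1) : PowerSeries.C a ∣ PowerSeries.rescale a f - 1 := by
  refine ⟨PowerSeries.mk fun k => if k = 0 then 0 else a ^ (k - 1) * PowerSeries.coeff k f, ?_⟩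
  ext k
  rw [map_sub, PowerSeries.coeff_rescale, PowerSeries.coeff_C_mul, PowerSeries.coeff_mk,
    PowerSeries.coeff_one]
  cases k with
  | zero => simp [hf]
  | succ k => simp [pow_succ']; ring

theorem dvd_prod_sub_one {A ι : Type*} [CommRing A] {a : A} (s : Finset ι) {f : ι → A}
    (h : ∀ i ∈ s, a ∣ f i - 1) : a ∣ ∏ i ∈ s, f i - 1 := by
  rw [← Ideal.mem_span_singleton, ← Ideal.Quotient.eq, map_prod, map_one]
  exact Finset.prod_eq_one fun i hi => by
    rw [← map_one (Ideal.Quotient.mk _), Ideal.Quotient.eq, Ideal.mem_span_singleton]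
    exact h i hi

/-- The factors of index at least M and the remainder f(t^(2M) y) are all 1 modulo t^(2M). The
estimate is made before substituting for y, while no negative powers of t are present. -/
theorem dvd_prod_sub_eulerSeries {M : ℕ} {s : Finset ℕ} (hs : Finset.range M ⊆ s) :
    PowerSeries.C ((PowerSeries.X ^ 2 : PowerSeries ℤ) ^ M) ∣
      (∏ i ∈ s, (1 - PowerSeries.C ((PowerSeries.X ^ 2 : PowerSeries ℤ) ^ i) * PowerSeries.X)) -
        eulerSeries := by
  have h1 : PowerSeries.C ((PowerSeries.X ^ 2 : PowerSeries ℤ) ^ M) ∣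
      (∏ i ∈ s \ Finset.range M,
        (1 - PowerSeries.C ((PowerSeries.X ^ 2 : PowerSeries ℤ) ^ i) * PowerSeries.X)) - 1 := by
    refine dvd_prod_sub_one _ fun i hi => ?_
    rw [sub_sub_cancel_left, dvd_neg]
    refine Dvd.dvd.mul_right (map_dvd _ (pow_dvd_pow _ ?_)) _
    simpa using (Finset.mem_sdiff.1 hi).2
  have h2 := C_dvd_rescale_sub_one ((PowerSeries.X ^ 2 : PowerSeries ℤ) ^ M) (f := eulerSeries)
    (by simp [eulerSeries, eulerCoeff])
  have h3 := (dvd_sub h1 h2).mul_left (∏ i ∈ Finset.range M,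
    (1 - PowerSeries.C ((PowerSeries.X ^ 2 : PowerSeries ℤ) ^ i) * PowerSeries.X))
  rw [sub_sub_sub_cancel_right, mul_sub, ← eulerSeries_eq_prod_mul,
    mul_comm, Finset.prod_sdiff hs] at h3
  exact h3

/-- The substitution `y ↦ t ^ m z ^ n`, from `ℤ⟦t⟧⟦y⟧` to `ℤ((t))⟦z⟧`. -/
noncomputable def substMonomial (n : ℕ) (hn : n ≠ 0) (m : ℤ) :
    PowerSeries (PowerSeries ℤ) →+* PowerSeries (LaurentSeries ℤ) :=
  (PowerSeries.expand n hn).toRingHom.comp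
    ((PowerSeries.rescale (qHalfPow m)).comp (PowerSeries.map (HahnSeries.ofPowerSeries ℤ ℤ)))

theorem substMonomial_apply (n : ℕ) (hn : n ≠ 0) (m : ℤ) (f : PowerSeries (PowerSeries ℤ)) :
    substMonomial n hn m f = PowerSeries.expand n hn (PowerSeries.rescale (qHalfPow m)
      (PowerSeries.map (HahnSeries.ofPowerSeries ℤ ℤ) f)) := rfl

theorem PowerSeries.rescale_C {S : Type*} [CommSemiring S] (a b : S) :
    PowerSeries.rescale a (PowerSeries.C b) = PowerSeries.C b := by
  ext1 k
  rw [PowerSeries.coeff_rescale, PowerSeries.coeff_C]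
  split_ifs with h <;> simp [h]

theorem substMonomial_C (n : ℕ) (hn : n ≠ 0) (m : ℤ) (i : ℕ) :
    substMonomial n hn m (PowerSeries.C ((PowerSeries.X ^ 2) ^ i)) =
      PowerSeries.C (qHalfPow 2 ^ i) := by
  rw [substMonomial_apply, PowerSeries.map_C, PowerSeries.rescale_C, PowerSeries.expand_C,
    map_pow,
    ofPowerSeries_X_pow_eq_qHalfPow]
  rfl

theorem substMonomial_X (n : ℕ) (hn : n ≠ 0) (m : ℤ) :
    substMonomial n hn m PowerSeries.X = qzMonomial n m := by
  rw [substMonomial_apply, PowerSeries.map_X, PowerSeries.rescale_X, map_mul, PowerSeries.expand_C,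
    PowerSeries.expand_X, qzMonomial, PowerSeries.monomial_eq_C_mul_X_pow]

theorem substMonomial_factor (n : ℕ) (hn : n ≠ 0) (m : ℤ) (i : ℕ) :
    substMonomial n hn m (1 - PowerSeries.C ((PowerSeries.X ^ 2) ^ i) * PowerSeries.X) =
      qPochhammerFactor (qzMonomial n m) i := by
  rw [map_sub, map_one, map_mul, substMonomial_C, substMonomial_X, qPochhammerFactor]

/-- The coefficients of f have no negative powers of t, so the order is bounded below independently
of f. -/
theorem coeff_coeff_substMonomial (n : ℕ) (hn : n ≠ 0) (m : ℤ) (f : PowerSeries (PowerSeries ℤ))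
    (l : ℕ) {p : ℤ} (hp : p < (l / n : ℕ) * m) :
    (PowerSeries.coeff l (substMonomial n hn m f)).coeff p = 0 := by
  rw [substMonomial_apply, PowerSeries.coeff_expand]
  split_ifs with h
  · rw [PowerSeries.coeff_rescale, qHalfPow_pow, qHalfPow, HahnSeries.coeff_single_mul,
      PowerSeries.coeff_map, PowerSeries.coeff_coe, if_pos (by omega), mul_zero]
  · rfl

open Filter in
theorem hasProd_qPochhammerFactor (n : ℕ) (hn : n ≠ 0) (m : ℤ) :
    HasProd (qPochhammerFactor (qzMonomial n m)) (substMonomial n hn m eulerSeries) := by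
  rw [HasProd, SummationFilter.unconditional_filter,
    PowerSeries.WithPiTopology.tendsto_iff_coeff_tendsto]
  intro l
  refine tendsto_laurentSeries fun k => ?_
  -- M is so large that, in z-degree l, an error divisible by t^(2M) has no terms below t^k.
  obtain ⟨M, hM⟩ : ∃ M : ℕ, k ≤ (l / n : ℕ) * m + 2 * M :=
    ⟨(k - (l / n : ℕ) * m).toNat, by have := Int.self_le_toNat (k - (l / n : ℕ) * m); omega⟩
  filter_upwards [eventually_ge_atTop (Finset.range M)] with s hs p hp
  obtain ⟨D, hD⟩ := dvd_prod_sub_eulerSeries hs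
  have h := congrArg (fun f => (PowerSeries.coeff l f).coeff p)
    (congrArg (substMonomial n hn m) hD)
  rw [map_sub, map_prod, map_mul, substMonomial_C] at h
  simp only [substMonomial_factor] at h
  rw [map_sub, PowerSeries.coeff_C_mul] at h
  rw [qHalfPow_two_pow, qHalfPow.eq_1 (2 * (M : ℤ)), HahnSeries.coeff_single_mul,
    coeff_coeff_substMonomial _ _ _ _ _ (by omega), mul_zero, HahnSeries.coeff_sub, sub_eq_zero] at h
  exact h

theorem qPochhammerInf_eq (n : ℕ) (hn : n ≠ 0) (m : ℤ) :
    qPochhammerInf (qzMonomial n m) = substMonomial n hn m eulerSeries :=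
  (hasProd_qPochhammerFactor n hn m).tprod_eq

theorem constantCoeff_qPochhammerInf (n : ℕ) (hn : n ≠ 0) (m : ℤ) :
    PowerSeries.constantCoeff (qPochhammerInf (qzMonomial n m)) = 1 := by
  rw [qPochhammerInf_eq n hn, substMonomial_apply, PowerSeries.constantCoeff_expand,
    ← PowerSeries.coeff_zero_eq_constantCoeff_apply, PowerSeries.coeff_rescale]
  simp [eulerSeries, eulerCoeff]

/-- Replacing z by qz multiplies y = t^m z^n by q^n, which removes the first n factors. -/
theorem qPochhammerInf_eq_prod_mul (n : ℕ) (hn : n ≠ 0) (m : ℤ) :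
    qPochhammerInf (qzMonomial n m) =
      (∏ i ∈ Finset.range n, qPochhammerFactor (qzMonomial n m) i) *
        PowerSeries.rescale (qHalfPow 2) (qPochhammerInf (qzMonomial n m)) := by
  have h := congrArg (substMonomial n hn m) (eulerSeries_eq_prod_mul n)
  simp only [map_mul, map_prod, substMonomial_factor] at h
  rw [qPochhammerInf_eq n hn, h]
  congr 1
  rw [← h]
  ext1 l
  rw [PowerSeries.coeff_rescale, substMonomial_apply, substMonomial_apply,
    PowerSeries.coeff_expand, PowerSeries.coeff_expand]
  split_ifs with hl
  · obtain ⟨k, rfl⟩ := hl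
    rw [Nat.mul_div_cancel_left _ (Nat.pos_of_ne_zero hn)]
    simp only [PowerSeries.coeff_rescale, PowerSeries.coeff_map, map_mul, map_pow]
    rw [← map_pow, ofPowerSeries_X_pow_eq_qHalfPow, ← pow_mul, Nat.cast_ofNat]
    ring
  · rw [mul_zero]

theorem coeff_qPochhammerInf_of_lt (n : ℕ) (hn : n ≠ 0) (m : ℤ) {k : ℕ} (h0 : k ≠ 0) (hk : k < n) :
    PowerSeries.coeff k (qPochhammerInf (qzMonomial n m)) = 0 := by
  rw [qPochhammerInf_eq n hn, substMonomial_apply, PowerSeries.coeff_expand,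
    if_neg fun h => h0 (Nat.eq_zero_of_dvd_of_lt h hk)]

/-- The leading coefficient -t^m / (1 - q) is the source of the denominator q - 1 in the choice of
exponents. -/
theorem coeff_qPochhammerInf_mul (n : ℕ) (hn : n ≠ 0) (m : ℤ) :
    PowerSeries.coeff n (qPochhammerInf (qzMonomial n m)) * (1 - qHalfPow 2) = -qHalfPow m := by
  have h := congrArg (HahnSeries.ofPowerSeries ℤ ℤ) (eulerCoeff_succ_mul 0)
  rw [qPochhammerInf_eq n hn, substMonomial_apply, PowerSeries.coeff_expand, if_pos dvd_rfl,
    Nat.div_self (Nat.pos_of_ne_zero hn), PowerSeries.coeff_rescale]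
  simp only [map_mul, map_sub, map_neg, map_pow, map_one, pow_zero, zero_add, pow_one, mul_one,
    eulerCoeff, eulerSeries, PowerSeries.coeff_map, PowerSeries.coeff_mk] at h ⊢
  rw [← map_pow, ofPowerSeries_X_pow_eq_qHalfPow, Nat.cast_ofNat] at h
  linear_combination qHalfPow m * h

/-! ### Gaussian binomials and q-commuting operators -/

/-- The Gaussian binomial coefficient `[n, k]` at `q`. -/
def gaussBinom {S : Type*} [CommRing S] (q : S) : ℕ → ℕ → S
  | _, 0 => 1
  | 0, _ + 1 => 0
  | n + 1, k + 1 => q ^ (k + 1) * gaussBinom q n (k + 1) + gaussBinom q n k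

section GaussBinom

variable {S : Type*} [CommRing S] (q : S)

theorem gaussBinom_zero_right (n : ℕ) : gaussBinom q n 0 = 1 := by
  cases n <;> rfl

theorem gaussBinom_succ_succ (n k : ℕ) : gaussBinom q (n + 1) (k + 1) =
    q ^ (k + 1) * gaussBinom q n (k + 1) + gaussBinom q n k := rfl

theorem gaussBinom_eq_zero {n k : ℕ} (h : n < k) : gaussBinom q n k = 0 := by
  induction n generalizing k with
  | zero => obtain ⟨k, rfl⟩ := Nat.exists_eq_add_of_lt h; simp [gaussBinom]
  | succ n ih =>
    obtain ⟨k, rfl⟩ : ∃ j, k = j + 1 := ⟨k - 1, by omega⟩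
    rw [gaussBinom_succ_succ, ih (by omega), ih (by omega), mul_zero, add_zero]

theorem gaussBinom_self (n : ℕ) : gaussBinom q n n = 1 := by
  induction n with
  | zero => rfl
  | succ n ih => rw [gaussBinom_succ_succ, gaussBinom_eq_zero q n.lt_succ_self, ih, mul_zero,
      zero_add]

/-- A division-free substitute for the quotient of q-factorials, so that it remains usable at roots
of unity. -/
theorem one_sub_pow_mul_gaussBinom (n k : ℕ) :
    (1 - q ^ (k + 1)) * gaussBinom q (n + 1) (k + 1) = (1 - q ^ (n + 1)) * gaussBinom q n k := by
  induction n generalizing k with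
  | zero => cases k <;> simp [gaussBinom]
  | succ n ih =>
    rw [gaussBinom_succ_succ q (n + 1) k]
    cases k with
    | zero =>
      have := ih 0
      simp only [gaussBinom_zero_right] at this ⊢
      linear_combination q * this
    | succ j =>
      linear_combination q ^ (j + 2) * ih (j + 1) + q * ih j -
        q * (1 - q ^ (n + 1)) * gaussBinom_succ_succ q n j

theorem gaussBinom_primitiveRoot [IsDomain S] {N k : ℕ} (hq : IsPrimitiveRoot q N) (h0 : 0 < k)
    (hk : k < N) : gaussBinom q N k = 0 := by
  obtain ⟨k, rfl⟩ : ∃ j, k = j + 1 := ⟨k - 1, by omega⟩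
  obtain ⟨N, rfl⟩ : ∃ j, N = j + 1 := ⟨N - 1, by omega⟩
  have h := one_sub_pow_mul_gaussBinom q N k
  rw [hq.pow_eq_one, sub_self, zero_mul] at h
  refine (mul_eq_zero.1 h).resolve_left fun h1 => ?_
  exact hq.pow_ne_one_of_pos_of_lt (by omega) hk (sub_eq_zero.1 h1).symm

variable {E : Type*} [Ring E] [Algebra S E] {q} {A B : E}

theorem add_pow_of_qCommute (h : A * B = q • (B * A)) (n : ℕ) :
    (A + B) ^ n = ∑ k ∈ Finset.range (n + 1), gaussBinom q n k • (B ^ k * A ^ (n - k)) := by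
  have hAB : ∀ k, A * B ^ k = q ^ k • (B ^ k * A) := by
    intro k
    induction k with
    | zero => simp
    | succ k ih =>
      rw [pow_succ B, ← mul_assoc, ih, smul_mul_assoc, mul_assoc, h, mul_smul_comm, smul_smul,
        pow_succ, mul_assoc]
  induction n with
  | zero => simp [gaussBinom]
  | succ n ih =>
    rw [pow_succ', ih, add_mul, Finset.mul_sum, Finset.mul_sum,
      Finset.sum_range_succ' _ (n + 1)]
    have h1 : ∑ k ∈ Finset.range (n + 1), A * gaussBinom q n k • (B ^ k * A ^ (n - k)) =
        ∑ k ∈ Finset.range (n + 1), (q ^ (k + 1) * gaussBinom q n (k + 1)) •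
          (B ^ (k + 1) * A ^ (n - k)) + A ^ (n + 1) := by
      have : ∀ k ∈ Finset.range (n + 1), A * gaussBinom q n k • (B ^ k * A ^ (n - k)) =
          (q ^ k * gaussBinom q n k) • (B ^ k * A ^ (n + 1 - k)) := by
        intro k hk
        rw [Nat.succ_sub (Finset.mem_range_succ_iff.1 hk), mul_smul_comm, ← mul_assoc, hAB,
          smul_mul_assoc, smul_smul, mul_assoc, ← pow_succ', mul_comm]
      rw [Finset.sum_congr rfl this, Finset.sum_range_succ', Finset.sum_range_succ (n := n),
        gaussBinom_eq_zero q n.lt_succ_self]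
      simp [gaussBinom_zero_right]
    have h2 : ∀ k, B * gaussBinom q n k • (B ^ k * A ^ (n - k)) =
        gaussBinom q n k • (B ^ (k + 1) * A ^ (n - k)) := by
      intro k
      rw [mul_smul_comm, ← mul_assoc, ← pow_succ']
    simp only [h1, h2, gaussBinom_succ_succ, add_smul, Finset.sum_add_distrib,
      Nat.add_sub_add_right, gaussBinom_zero_right, pow_zero, one_mul, one_smul, Nat.sub_zero]
    abel

theorem add_pow_of_qCommute_primitiveRoot [IsDomain S] {N : ℕ} (hN : 0 < N)
    (hq : IsPrimitiveRoot q N) (h : A * B = q • (B * A)) : (A + B) ^ N = A ^ N + B ^ N := by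
  obtain ⟨n, rfl⟩ : ∃ j, N = j + 1 := ⟨N - 1, by omega⟩
  rw [add_pow_of_qCommute h, Finset.sum_range_succ, Finset.sum_range_succ', Finset.sum_eq_zero]
  · simp [gaussBinom_zero_right, gaussBinom_self]
  · intro k hk
    rw [gaussBinom_primitiveRoot q hq k.succ_pos (by simpa using hk), zero_smul]

end GaussBinom

/-- u is fixed by A + B, with A the shift by 1 and B the weighted shift by e. The rule for b says AB
= q BA, so A^N + B^N = (A + B)^N fixes u too; evaluate at 0. -/
theorem eq_add_prod_mul_of_qDifference {S : Type*} [CommRing S] [IsDomain S] {q : S} {N : ℕ}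
    (hN : 0 < N) (hq : IsPrimitiveRoot q N) {b u : ℤ → S} (e : ℤ)
    (hb : ∀ i, b (i + 1) = q * b i) (hu : ∀ i, u i = u (i + 1) + b i * u (i + e)) :
    u 0 = u N + (∏ j ∈ Finset.range N, b (j * e)) * u (N * e) := by
  let A : Module.End S (ℤ → S) := LinearMap.funLeft S S (· + 1)
  let B : Module.End S (ℤ → S) :=
    { toFun := fun v i => b i * v (i + e)
      map_add' := fun v w => by ext i; simp [mul_add]
      map_smul' := fun c v => by ext i; simp [mul_left_comm] }
  have hA : ∀ k v i, (A ^ k) v i = v (i + (k : ℕ)) := by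
    intro k
    induction k with
    | zero => simp
    | succ k ih =>
      intro v i
      rw [pow_succ', Module.End.mul_apply]
      change (A ^ k) v (i + 1) = _
      rw [ih]
      push_cast
      ring_nf
  have hB : ∀ k v i, (B ^ k) v i =
      (∏ j ∈ Finset.range k, b (i + j * e)) * v (i + (k : ℕ) * e) := by
    intro k
    induction k with
    | zero => simp
    | succ k ih =>
      intro v i
      rw [pow_succ', Module.End.mul_apply]
      change b i * (B ^ k) v (i + e) = _
      rw [ih, Finset.prod_range_succ']
      push_cast
      ring_nf
  have hAB : A * B = q • (B * A) := by
    ext1 v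
    funext i
    change b (i + 1) * v (i + 1 + e) = q * (b i * v (i + e + 1))
    rw [hb, mul_assoc, add_right_comm]
  have hfix : (A + B) u = u := funext fun i => (hu i).symm
  have hpow : ((A + B) ^ N) u = u := by
    rw [Module.End.pow_apply]
    exact Function.iterate_fixed hfix N
  rw [add_pow_of_qCommute_primitiveRoot hN hq hAB] at hpow
  have := congrFun hpow 0
  rw [LinearMap.add_apply, Pi.add_apply, hA, hB] at this
  simpa using this.symm

/-! ### Laurent polynomials, root-of-unity compatibility and admissibility -/

open scoped LaurentPolynomial

/-- The unit `q^{1/2}` of `ℤ((q^{1/2}))`. -/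
noncomputable def qHalfUnit : (LaurentSeries ℤ)ˣ where
  val := qHalfPow 1
  inv := qHalfPow (-1)
  val_inv := by rw [← qHalfPow_add]; rfl
  inv_val := by rw [← qHalfPow_add]; rfl

theorem qHalfUnit_zpow (m : ℤ) : ((qHalfUnit ^ m : (LaurentSeries ℤ)ˣ) : LaurentSeries ℤ) =
    qHalfPow m := by
  induction m with
  | zero => rfl
  | succ k ih => rw [zpow_add_one, Units.val_mul, ih, qHalfPow_add]; rfl
  | pred k ih => rw [zpow_sub_one, Units.val_mul, ih, sub_eq_add_neg, qHalfPow_add]; rfl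

/-- The inclusion of the Laurent polynomials into the Laurent series. -/
noncomputable def laurentIncl : ℤ[T;T⁻¹] →+* LaurentSeries ℤ :=
  LaurentPolynomial.eval₂ (Int.castRingHom _) qHalfUnit

theorem laurentIncl_T (m : ℤ) : laurentIncl (LaurentPolynomial.T m) = qHalfPow m := by
  rw [laurentIncl, LaurentPolynomial.eval₂_T, qHalfUnit_zpow]

theorem laurentIncl_C_mul_T (a m : ℤ) : laurentIncl (LaurentPolynomial.C a * LaurentPolynomial.T m) =
    HahnSeries.single m a := by
  rw [map_mul, laurentIncl_T, laurentIncl, LaurentPolynomial.eval₂_C, eq_intCast, qHalfPow,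
    ← zsmul_eq_mul]
  ext k
  rw [HahnSeries.coeff_smul, HahnSeries.coeff_single, HahnSeries.coeff_single, smul_ite, smul_zero,
    smul_eq_mul, mul_one]

theorem coeff_laurentIncl (f : ℤ[T;T⁻¹]) (m : ℤ) : (laurentIncl f).coeff m = f.coeff m := by
  induction f using LaurentPolynomial.induction_on' with
  | add f g hf hg => rw [map_add, HahnSeries.coeff_add, hf, hg]; rfl
  | C_mul_T n a =>
    rw [laurentIncl_C_mul_T, ← LaurentPolynomial.single_eq_C_mul_T]
    rw [HahnSeries.coeff_single, AddMonoidAlgebra.coeff_single]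
    rcases eq_or_ne m n with rfl | h
    · rw [if_pos rfl, Finsupp.single_eq_same]
    · rw [if_neg h, Finsupp.single_eq_of_ne h]

theorem laurentIncl_injective : Function.Injective laurentIncl := by
  intro f g h
  ext m
  have := congrArg (fun x => x.coeff m) h
  simpa only [coeff_laurentIncl] using this

/-- Evaluation of Laurent polynomials at a nonzero complex number. -/
noncomputable def laurentEval (t : ℂˣ) : ℤ[T;T⁻¹] →+* ℂ :=
  LaurentPolynomial.eval₂ (Int.castRingHom ℂ) t

theorem laurentEval_T (t : ℂˣ) (m : ℤ) :
    laurentEval t (LaurentPolynomial.T m) = ((t ^ m : ℂˣ) : ℂ) :=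
  LaurentPolynomial.eval₂_T _ _ _

/-- `G ↦ ∏_{i < N} G(t ^ (2 i) z; t)`. -/
noncomputable def rootNorm (N : ℕ) (t : ℂˣ) : PowerSeries ℤ[T;T⁻¹] →* PowerSeries ℂ :=
  ∏ i ∈ Finset.range N,
    (((PowerSeries.rescale ((t : ℂ) ^ (2 * i))).comp (PowerSeries.map (laurentEval t)) :
      PowerSeries ℤ[T;T⁻¹] →+* PowerSeries ℂ) : PowerSeries ℤ[T;T⁻¹] →* PowerSeries ℂ)

theorem rootNorm_apply (N : ℕ) (t : ℂˣ) (G : PowerSeries ℤ[T;T⁻¹]) : rootNorm N t G =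
    ∏ i ∈ Finset.range N, PowerSeries.rescale ((t : ℂ) ^ (2 * i))
      (PowerSeries.map (laurentEval t) G) := by
  rw [rootNorm, MonoidHom.finsetProd_apply]
  rfl

/-- `G ↦ G(z ^ N; t ^ N)`. -/
noncomputable def powerTwist (N : ℕ+) (t : ℂˣ) : PowerSeries ℤ[T;T⁻¹] →* PowerSeries ℂ :=
  (((PowerSeries.expand (N : ℕ) N.ne_zero).toRingHom.comp
    (PowerSeries.map (laurentEval (t ^ (N : ℕ)))) :
      PowerSeries ℤ[T;T⁻¹] →+* PowerSeries ℂ) : PowerSeries ℤ[T;T⁻¹] →* PowerSeries ℂ)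

theorem powerTwist_apply (N : ℕ+) (t : ℂˣ) (G : PowerSeries ℤ[T;T⁻¹]) : powerTwist N t G =
    PowerSeries.expand (N : ℕ) N.ne_zero (PowerSeries.map (laurentEval (t ^ (N : ℕ))) G) := rfl

/-- The units `G` of `ℤ[q^{±1/2}]⟦z⟧` with `∏_{i < N} G(ζ ^ i z; t) = G(z ^ N; t ^ N)` whenever
`ζ = t ^ 2` is a primitive `N`-th root of unity. -/
noncomputable def rootCompatible : Subgroup (PowerSeries ℤ[T;T⁻¹])ˣ :=
  ⨅ (N : ℕ+) (t : ℂˣ) (_ : IsPrimitiveRoot ((t : ℂ) ^ 2) N),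
    (Units.map (rootNorm N t)).eqLocus (Units.map (powerTwist N t))

theorem mem_rootCompatible {G : (PowerSeries ℤ[T;T⁻¹])ˣ} : G ∈ rootCompatible ↔
    ∀ (N : ℕ+) (t : ℂˣ), IsPrimitiveRoot ((t : ℂ) ^ 2) N →
      rootNorm N t G = powerTwist N t G := by
  simp only [rootCompatible, Subgroup.mem_iInf]
  exact forall_congr' fun N => forall_congr' fun t => forall_congr' fun _ => Units.ext_iff

/-- The units `F` of `ℤ((q^{1/2}))⟦z⟧` for which `F(q z) / F(z)` has Laurent polynomial
coefficients and is compatible with roots of unity. -/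
noncomputable def admissible : Subgroup (PowerSeries (LaurentSeries ℤ))ˣ :=
  (rootCompatible.map (Units.map (PowerSeries.map laurentIncl : _ →* _))).comap
    (Units.map (PowerSeries.rescale (qHalfPow 2) : _ →* _) / MonoidHom.id _)

theorem mem_admissible {F : (PowerSeries (LaurentSeries ℤ))ˣ} : F ∈ admissible ↔
    ∃ G ∈ rootCompatible, PowerSeries.map laurentIncl G * F =
      PowerSeries.rescale (qHalfPow 2) (F : PowerSeries (LaurentSeries ℤ)) := by
  rw [admissible, Subgroup.mem_comap, Subgroup.mem_map]
  refine exists_congr fun G => and_congr_right fun _ => ?_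
  rw [MonoidHom.div_apply, eq_div_iff_mul_eq', Units.ext_iff]
  rfl

/-! ### Admissibility of the Pochhammer symbols -/

theorem prod_range_mul_eq {S : Type*} [CommMonoid S] (f : ℕ → S) (n N : ℕ) :
    ∏ r ∈ Finset.range (N * n), f r =
      ∏ l ∈ Finset.range N, ∏ i ∈ Finset.range n, f (i + l * n) := by
  induction N with
  | zero => simp
  | succ N ih =>
    rw [Nat.succ_mul, Finset.prod_range_add, ih, Finset.prod_range_succ]
    simp only [add_comm]

theorem prod_one_sub_pow_mul {S : Type*} [CommRing S] [IsDomain S] {q : S} {N : ℕ} (hN : 0 < N)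
    (hq : IsPrimitiveRoot q N) (x : S) : ∏ l ∈ Finset.range N, (1 - q ^ l * x) = 1 - x ^ N := by
  have h := hq.pow_sub_pow_eq_prod_sub_mul 1 x hN
  rw [one_pow] at h
  rw [h]
  refine Finset.prod_bij (fun i _ => q ^ i) (fun i _ => ?_) (fun i hi j hj hij => ?_)
    (fun b hb => ?_) fun _ _ => rfl
  · rw [Polynomial.mem_nthRootsFinset hN, ← pow_mul, mul_comm, pow_mul, hq.pow_eq_one, one_pow]
  · exact hq.pow_inj (Finset.mem_range.1 hi) (Finset.mem_range.1 hj) hij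
  · have : NeZero N := ⟨hN.ne'⟩
    obtain ⟨i, hi, h⟩ := hq.eq_pow_of_pow_eq_one ((Polynomial.mem_nthRootsFinset hN 1).1 hb)
    exact ⟨i, Finset.mem_range.2 hi, h⟩

/-- The exponents i + l n run once through 0, …, N n - 1, hence n times through the residues modulo
N. -/
theorem prod_prod_one_sub_pow_mul {S : Type*} [CommRing S] [IsDomain S] {q : S} {N : ℕ}
    (hN : 0 < N) (hq : IsPrimitiveRoot q N) (n : ℕ) (x : S) :
    ∏ l ∈ Finset.range N, ∏ i ∈ Finset.range n, (1 - q ^ (i + l * n) * x) = (1 - x ^ N) ^ n := by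
  rw [← prod_range_mul_eq (fun r => 1 - q ^ r * x), mul_comm,
    prod_range_mul_eq (fun r => 1 - q ^ r * x)]
  have : ∀ l i, q ^ (i + l * N) = q ^ i := by
    intro l i
    rw [pow_add, mul_comm l, pow_mul, hq.pow_eq_one, one_pow, mul_one]
  simp only [this, prod_one_sub_pow_mul hN hq, Finset.prod_const, Finset.card_range]

theorem isUnit_of_constantCoeff_eq_one {S : Type*} [CommRing S] {F : PowerSeries S}
    (hF : PowerSeries.constantCoeff F = 1) : IsUnit F :=
  PowerSeries.isUnit_iff_constantCoeff.2 (hF ▸ isUnit_one)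

/-- `∏_{i < n} (1 - q ^ (m / 2 + i) z ^ n)`. -/
noncomputable def ratioFactor (n : ℕ) (m : ℤ) : PowerSeries ℤ[T;T⁻¹] :=
  ∏ i ∈ Finset.range n, (1 - PowerSeries.C (LaurentPolynomial.T (m + 2 * i)) * PowerSeries.X ^ n)

theorem isUnit_ratioFactor (n : ℕ+) (m : ℤ) : IsUnit (ratioFactor n m) :=
  isUnit_of_constantCoeff_eq_one (by simp [ratioFactor])

/-- At t^N the value of q is 1, so the twisted side collapses to an n-th power, the same one that
the norm gives by running n times through all residues. -/
theorem ratioFactor_mem (n : ℕ+) (m : ℤ) : (isUnit_ratioFactor n m).unit ∈ rootCompatible := by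
  rw [mem_rootCompatible]
  intro N t ht
  have hC : IsPrimitiveRoot (PowerSeries.C ((t : ℂ) ^ 2)) N :=
    ht.map_of_injective PowerSeries.C_injective
  rw [IsUnit.unit_spec, rootNorm_apply, powerTwist_apply, ratioFactor]
  simp only [map_prod, map_sub, map_one, map_mul, map_pow, PowerSeries.map_C, PowerSeries.map_X,
    laurentEval_T, PowerSeries.rescale_X, PowerSeries.expand_C, PowerSeries.expand_X]
  have h := prod_prod_one_sub_pow_mul N.pos hC n
    (PowerSeries.C ((t ^ m : ℂˣ) : ℂ) * PowerSeries.X ^ (n : ℕ))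
  refine Eq.trans (Finset.prod_congr rfl fun l _ => Finset.prod_congr rfl fun i _ => ?_)
    (h.trans ?_)
  · rw [PowerSeries.rescale_C, zpow_add, Units.val_mul, map_mul]
    have : ((t ^ (2 * (i : ℤ)) : ℂˣ) : ℂ) = ((t : ℂ) ^ 2) ^ i := by
      rw [zpow_mul, zpow_natCast, Units.val_pow_eq_pow_val, zpow_ofNat, Units.val_pow_eq_pow_val]
    rw [this, mul_pow, ← map_pow, ← map_pow, ← map_pow]
    have h2 : ((t : ℂ) ^ 2) ^ (i + l * (n : ℕ)) = ((t : ℂ) ^ 2) ^ i * ((t : ℂ) ^ (2 * l)) ^ (n : ℕ) := by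
      ring
    rw [h2, map_mul]
    ring
  · have ht' : (t ^ (N : ℕ)) ^ (2 : ℤ) = 1 := by
      ext
      rw [zpow_ofNat, ← pow_mul, mul_comm, pow_mul, Units.val_pow_eq_pow_val,
        Units.val_pow_eq_pow_val, ht.pow_eq_one, Units.val_one]
    have : ∀ i : ℕ, (t ^ (N : ℕ)) ^ (m + 2 * (i : ℤ)) = (t ^ m) ^ (N : ℕ) := by
      intro i
      rw [zpow_add, zpow_mul _ 2, ht', one_zpow, mul_one, ← zpow_natCast, ← zpow_natCast,
        ← zpow_mul, ← zpow_mul, mul_comm]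
    simp only [this, Finset.prod_const, Finset.card_range]
    rw [Units.val_pow_eq_pow_val, mul_pow, map_pow, ← pow_mul, ← pow_mul, mul_comm (n : ℕ)]

/-- The unit `(q^{m/2} z ^ n; q)_∞`. -/
noncomputable def pochhammerUnit (n : ℕ+) (m : ℤ) : (PowerSeries (LaurentSeries ℤ))ˣ :=
  (isUnit_of_constantCoeff_eq_one (constantCoeff_qPochhammerInf n n.ne_zero m)).unit

theorem pochhammerUnit_val (n : ℕ+) (m : ℤ) :
    (pochhammerUnit n m : PowerSeries (LaurentSeries ℤ)) = qPochhammerInf (qzMonomial n m) := rfl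

theorem map_ratioFactor (n : ℕ) (m : ℤ) : PowerSeries.map laurentIncl (ratioFactor n m) =
    ∏ i ∈ Finset.range n, qPochhammerFactor (qzMonomial n m) i := by
  rw [ratioFactor, map_prod]
  refine Finset.prod_congr rfl fun i _ => ?_
  rw [map_sub, map_one, map_mul, map_pow, PowerSeries.map_C, PowerSeries.map_X, laurentIncl_T,
    qPochhammerFactor, qHalfPow_two_pow, qzMonomial, PowerSeries.monomial_eq_C_mul_X_pow,
    ← mul_assoc, ← map_mul, ← qHalfPow_add, add_comm]

/-- The ratio F(qz) / F(z) is the inverse of `ratioFactor`. -/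
theorem pochhammerUnit_mem (n : ℕ+) (m : ℤ) : pochhammerUnit n m ∈ admissible := by
  rw [mem_admissible]
  refine ⟨_, inv_mem (ratioFactor_mem n m), ?_⟩
  rw [pochhammerUnit_val]
  conv_lhs => rw [qPochhammerInf_eq_prod_mul _ n.ne_zero, ← map_ratioFactor]
  rw [← mul_assoc, ← map_mul, IsUnit.val_inv_mul, map_one, one_mul]

/-! ### Root-of-unity compatibility of cocycles -/

/-- Multiplicativity makes w 1 - w' 1 divide w e - w' e, also for negative e. Subtracting the two
equations then gives (1 + a c) (w 1 - w' 1) = 0 with a unit in front. -/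
theorem eq_of_one_eq_add {S : Type*} [CommRing S] {w w' : ℤ → S}
    (h0 : w 0 = 1) (h0' : w' 0 = 1) (hw : ∀ i j, w (i + j) = w i * w j)
    (hw' : ∀ i j, w' (i + j) = w' i * w' j) {a : S} {e : ℤ} (ha : ∀ c, IsUnit (1 + a * c))
    (h : 1 = w 1 + a * w e) (h' : 1 = w' 1 + a * w' e) : w 1 = w' 1 := by
  have hd : ∀ k : ℤ, w 1 - w' 1 ∣ w k - w' k := by
    intro k
    have hneg : ∀ k, w 1 - w' 1 ∣ w k - w' k → w 1 - w' 1 ∣ w (-k) - w' (-k) := by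
      rintro k ⟨c, hc⟩
      refine ⟨-(w (-k) * w' (-k) * c), ?_⟩
      have h1 := hw k (-k)
      have h2 := hw' k (-k)
      rw [add_neg_cancel, h0] at h1
      rw [add_neg_cancel, h0'] at h2
      linear_combination w (-k) * h2 - w' (-k) * h1 - w (-k) * w' (-k) * hc
    have hnat : ∀ k : ℕ, w 1 - w' 1 ∣ w k - w' k := by
      intro k
      induction k with
      | zero => simp [h0, h0']
      | succ k ih =>
        obtain ⟨c, hc⟩ := ih
        refine ⟨w k + w' 1 * c, ?_⟩
        push_cast
        rw [hw, hw']
        linear_combination w' 1 * hc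
    obtain ⟨k, rfl | rfl⟩ := k.eq_nat_or_neg
    · exact hnat k
    · exact hneg _ (hnat k)
  obtain ⟨c, hc⟩ := hd e
  have : (1 + a * c) * (w 1 - w' 1) = 0 := by linear_combination h' - h - a * hc
  exact sub_eq_zero.1 ((ha c).mul_right_eq_zero.1 this)

/-- Here (t^N)² = 1. For even N, t^N = (t²)^(N/2) is not 1, so it is -1; for odd N only signs are
compared. This is where the sign twist of the series enters. -/
theorem neg_pow_sq_eq {t : ℂˣ} {N : ℕ+} (ht : IsPrimitiveRoot ((t : ℂ) ^ 2) N) :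
    (-t) ^ ((N : ℕ) ^ 2) = -(t ^ (N : ℕ)) := by
  have h2 : (t ^ (N : ℕ)) ^ 2 = 1 := by
    ext
    rw [← pow_mul, mul_comm, pow_mul, Units.val_pow_eq_pow_val, Units.val_pow_eq_pow_val,
      ht.pow_eq_one, Units.val_one]
  rcases Nat.even_or_odd' (N : ℕ) with ⟨k, hk | hk⟩
  · have hN := N.pos
    have h1 : t ^ (N : ℕ) ≠ 1 := by
      intro h
      refine ht.pow_ne_one_of_pos_of_lt (l := k) (by omega) (by omega) ?_
      rw [← pow_mul, ← hk, ← Units.val_pow_eq_pow_val, h, Units.val_one]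
    have h3 : t ^ (N : ℕ) = -1 := by
      have h4 : ((t ^ (N : ℕ) : ℂˣ) : ℂ) ^ 2 = 1 := by
        rw [← Units.val_pow_eq_pow_val, h2, Units.val_one]
      rcases sq_eq_sq_iff_eq_or_eq_neg.1 (h4.trans (one_pow 2).symm) with h | h
      · exact absurd (Units.ext h) h1
      · exact Units.ext h
    have he : Even (N : ℕ) := ⟨k, by omega⟩
    rw [pow_two, pow_mul, he.neg_pow, h3, he.neg_one_pow, neg_neg]
  · have ho : Odd (N : ℕ) := ⟨k, hk⟩
    rw [pow_two, pow_mul, ho.neg_pow, ho.neg_pow, hk, pow_succ, pow_mul, ← hk, h2, one_pow, one_mul]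

/-- The odd numbers 1 + 2j with j < N sum to N². -/
theorem prod_C_mul_X_eq (y : ℂˣ) (e : ℤ) (N : ℕ) :
    ∏ j ∈ Finset.range N, (PowerSeries.C ((y ^ (e + 2 * ((j : ℤ) * e)) : ℂˣ) : ℂ) * PowerSeries.X) =
      PowerSeries.C ((y ^ (e * (N : ℤ) ^ 2) : ℂˣ) : ℂ) * PowerSeries.X ^ N := by
  induction N with
  | zero => simp
  | succ N ih =>
    have : e * ((N + 1 : ℕ) : ℤ) ^ 2 = e * (N : ℤ) ^ 2 + (e + 2 * ((N : ℤ) * e)) := by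
      push_cast; ring
    rw [Finset.prod_range_succ, ih, this, zpow_add y (e * (N : ℤ) ^ 2), Units.val_mul,
      map_mul, pow_succ]
    ring

/-- A cocycle `ρ` over `ℤ[T;T⁻¹]⟦z⟧` (for `z ↦ q z`) with
`ρ i = ρ (i + 1) + (-q^{1/2}) ^ e q ^ i z ρ (i + e)` is compatible with roots of unity. -/
theorem rootNorm_eq_powerTwist_of_cocycle {ρ : ℤ → PowerSeries ℤ[T;T⁻¹]} {e : ℤ} (h0 : ρ 0 = 1)
    (hadd : ∀ i j, ρ (i + j) =
      ρ i * PowerSeries.rescale (LaurentPolynomial.T (2 * i)) (ρ j))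
    (hρ : ∀ i, ρ i = ρ (i + 1) + PowerSeries.C (LaurentPolynomial.C
      ((e.negOnePow : ℤˣ) : ℤ) * LaurentPolynomial.T (e + 2 * i)) * PowerSeries.X * ρ (i + e))
    {N : ℕ+} {t : ℂˣ} (ht : IsPrimitiveRoot ((t : ℂ) ^ 2) N) :
    rootNorm N t (ρ 1) = powerTwist N t (ρ 1) := by
  have hC : IsPrimitiveRoot (PowerSeries.C ((t : ℂ) ^ 2)) N :=
    ht.map_of_injective PowerSeries.C_injective
  have hsign : ∀ (s : ℂˣ) (i : ℤ), laurentEval s (LaurentPolynomial.C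
      ((e.negOnePow : ℤˣ) : ℤ) * LaurentPolynomial.T (e + 2 * i)) = (((-s) ^ (e + 2 * i) : ℂˣ) : ℂ) := by
    intro s i
    rw [map_mul, laurentEval_T, laurentEval, LaurentPolynomial.eval₂_C, eq_intCast]
    rcases Int.even_or_odd e with h | h
    · rw [Int.negOnePow_even e h, (h.add (even_two_mul i)).neg_zpow]
      simp
    · rw [Int.negOnePow_odd e h, (h.add_even (even_two_mul i)).neg_zpow]
      simp
  have hadd' : ∀ (s : ℂˣ) i j, PowerSeries.map (laurentEval s) (ρ (i + j)) =
      PowerSeries.map (laurentEval s) (ρ i) * PowerSeries.rescale ((s ^ (2 * i) : ℂˣ) : ℂ)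
        (PowerSeries.map (laurentEval s) (ρ j)) := by
    intro s i j
    rw [hadd, map_mul, ← laurentEval_T, PowerSeries.rescale_map]
  have hρ' : ∀ (s : ℂˣ) i, PowerSeries.map (laurentEval s) (ρ i) =
      PowerSeries.map (laurentEval s) (ρ (i + 1)) +
      PowerSeries.C (((-s) ^ (e + 2 * i) : ℂˣ) : ℂ) * PowerSeries.X *
        PowerSeries.map (laurentEval s) (ρ (i + e)) := by
    intro s i
    conv_lhs => rw [hρ i]
    rw [map_add, map_mul, map_mul, PowerSeries.map_C, PowerSeries.map_X, hsign]
  have hneg2 : ∀ i : ℤ, (-t) ^ (2 * i) = t ^ (2 * i) := fun i => (even_two_mul i).neg_zpow t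
  have htN : t ^ (2 * (N : ℤ)) = 1 := by
    ext
    rw [zpow_mul, zpow_natCast, zpow_ofNat, Units.val_pow_eq_pow_val, Units.val_pow_eq_pow_val,
      ht.pow_eq_one, Units.val_one]
  -- The cocycle rule telescopes the norm of ρ 1 to ρ N.
  have hA : rootNorm N t (ρ 1) = PowerSeries.map (laurentEval t) (ρ (N : ℕ)) := by
    rw [rootNorm_apply]
    have : ∀ k : ℕ, ∏ i ∈ Finset.range k, PowerSeries.rescale ((t : ℂ) ^ (2 * i))
        (PowerSeries.map (laurentEval t) (ρ 1)) = PowerSeries.map (laurentEval t) (ρ k) := by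
      intro k
      induction k with
      | zero => simp [h0]
      | succ k ih =>
        rw [Finset.prod_range_succ, ih, Nat.cast_succ, hadd' t k 1]
        congr 2
    exact this N
  rw [hA, powerTwist_apply]
  have hu := eq_add_prod_mul_of_qDifference N.pos hC
    (b := fun i => PowerSeries.C (((-t) ^ (e + 2 * i) : ℂˣ) : ℂ) * PowerSeries.X)
    (u := fun i => PowerSeries.map (laurentEval t) (ρ i)) e ?_ (hρ' t)
  · rw [prod_C_mul_X_eq, h0, map_one] at hu
    have hv := congrArg (PowerSeries.expand (N : ℕ) N.ne_zero) (hρ' (t ^ (N : ℕ)) 0)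
    have hc : (-t) ^ (e * ((N : ℕ) : ℤ) ^ 2) = (-(t ^ (N : ℕ))) ^ (e + 2 * 0) := by
      rw [mul_comm, zpow_mul, mul_zero, add_zero, ← neg_pow_sq_eq ht]
      norm_cast
    rw [h0, map_one, map_one, zero_add, zero_add, map_add, map_mul, map_mul, PowerSeries.expand_C,
      PowerSeries.expand_X, ← hc] at hv
    have htN' : (t ^ (N : ℕ)) ^ (2 : ℤ) = 1 := by
      rw [← htN, mul_comm, zpow_mul, zpow_natCast]
    rw [← mul_one ((N : ℕ) : ℤ)]
    -- As q^N = 1, the rescalings in the cocycle rule become trivial, so both families are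
    -- multiplicative in i. By `neg_pow_sq_eq` they satisfy the same equation, whose coefficient is
    -- divisible by z^N.
    refine eq_of_one_eq_add (w := fun i => PowerSeries.map (laurentEval t) (ρ ((N : ℕ) * i)))
      (w' := fun i => PowerSeries.expand (N : ℕ) N.ne_zero
        (PowerSeries.map (laurentEval (t ^ (N : ℕ))) (ρ i)))
      ?_ ?_ ?_ ?_ ?_ ?_ hv
    · rw [mul_zero, h0, map_one]
    · rw [h0, map_one, map_one]
    · intro i j
      rw [mul_add, hadd', ← mul_assoc, zpow_mul, htN, one_zpow, Units.val_one,
        PowerSeries.rescale_one, RingHom.id_apply]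
    · intro i j
      rw [hadd', zpow_mul, htN', one_zpow, Units.val_one, PowerSeries.rescale_one, RingHom.id_apply,
        map_mul]
    · intro c
      refine isUnit_of_constantCoeff_eq_one ?_
      simp
    · rw [mul_one]
      exact hu
  · intro i
    have : e + 2 * (i + 1) = 2 * 1 + (e + 2 * i) := by ring
    rw [this, zpow_add, hneg2, mul_one, zpow_ofNat, Units.val_mul, Units.val_pow_eq_pow_val,
      map_mul, mul_assoc]

/-! ### The q-difference equation and admissibility of the Hilbert series -/

theorem one_sub_qHalfPow_ne_zero {m : ℤ} (hm : m ≠ 0) : 1 - qHalfPow m ≠ 0 := by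
  intro h
  have := congrArg (fun x => x.coeff 0) h
  rw [HahnSeries.coeff_sub, HahnSeries.coeff_one, if_pos rfl, qHalfPow,
    HahnSeries.coeff_single_of_ne hm.symm] at this
  simp at this

theorem prod_one_sub_ne_zero (n : ℕ) : ∏ i ∈ Finset.Icc 1 n, (1 - qHalfPow 2 ^ i) ≠ 0 := by
  refine Finset.prod_ne_zero_iff.2 fun i hi => ?_
  rw [qHalfPow_two_pow]
  exact one_sub_qHalfPow_ne_zero (by have := (Finset.mem_Icc.1 hi).1; omega)

/-- The monomial `(-q^{1/2}) ^ e`. -/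
noncomputable def signedPow (e : ℤ) : LaurentSeries ℤ :=
  HahnSeries.single e ((e.negOnePow : ℤˣ) : ℤ)

/-- Coefficient form of the q-difference equation; it reflects (n + 1)² = n² + 2n + 1 in the closed
form. -/
theorem hilbertCoeff_succ_mul (d n : ℕ) : hilbertCoeff d (n + 1) * (1 - qHalfPow 2 ^ (n + 1)) =
    signedPow (1 - d) * qHalfPow (2 * (1 - d)) ^ n * hilbertCoeff d n := by
  apply mul_right_cancel₀ (prod_one_sub_ne_zero n)
  have h := hilbertCoeff_mul_prod d (n + 1)
  rw [Finset.prod_Icc_succ_top (by omega)] at h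
  rw [mul_assoc, mul_comm (1 - _), h, mul_assoc, hilbertCoeff_mul_prod, signedPow, qHalfPow_pow, qHalfPow,
    HahnSeries.single_mul_single, HahnSeries.single_mul_single, mul_one]
  have : (1 - (d : ℤ)) * ((n + 1 : ℕ) : ℤ) ^ 2 =
    (1 - (d : ℤ)) + 2 * (n * (1 - (d : ℤ))) + (1 - (d : ℤ)) * (n : ℤ) ^ 2 := by push_cast; ring
  rw [this, Int.negOnePow_add, Int.negOnePow_add, Int.negOnePow_two_mul, mul_one, Units.val_mul,
    mul_left_comm 2]

theorem hilbertCoeff_zero (d : ℕ) : hilbertCoeff d 0 = 1 := by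
  have := hilbertCoeff_mul_prod d 0
  simpa using this

theorem constantCoeff_hilbertSeries (d : ℕ) :
    PowerSeries.constantCoeff (hilbertSeries d) = 1 := by
  rw [← PowerSeries.coeff_zero_eq_constantCoeff_apply, hilbertSeries, PowerSeries.coeff_mk,
    hilbertCoeff_zero]

theorem hilbertSeries_eq (d : ℕ) : hilbertSeries d =
    PowerSeries.rescale (qHalfPow 2) (hilbertSeries d) +
      PowerSeries.C (signedPow (1 - d)) * PowerSeries.X *
        PowerSeries.rescale (qHalfPow (2 * (1 - d))) (hilbertSeries d) := by
  ext1 n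
  rw [map_add, PowerSeries.coeff_rescale, mul_assoc, PowerSeries.coeff_C_mul]
  cases n with
  | zero => simp
  | succ n =>
    rw [PowerSeries.coeff_succ_X_mul, PowerSeries.coeff_rescale]
    simp only [hilbertSeries, PowerSeries.coeff_mk]
    linear_combination hilbertCoeff_succ_mul d n

/-- The Hilbert–Poincaré series as a unit. -/
noncomputable def hilbertUnit (d : ℕ) : (PowerSeries (LaurentSeries ℤ))ˣ :=
  (isUnit_of_constantCoeff_eq_one (constantCoeff_hilbertSeries d)).unit

theorem hilbertUnit_val (d : ℕ) :
    (hilbertUnit d : PowerSeries (LaurentSeries ℤ)) = hilbertSeries d := rfl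

/-- The ratio `P(q ^ i z) / P(z)`. -/
noncomputable def hilbertRatio (d : ℕ) (i : ℤ) : PowerSeries (LaurentSeries ℤ) :=
  PowerSeries.rescale (qHalfPow (2 * i)) (hilbertSeries d) * ((hilbertUnit d)⁻¹ : _ˣ)

theorem hilbertRatio_mul (d : ℕ) (i : ℤ) : hilbertRatio d i * hilbertSeries d =
    PowerSeries.rescale (qHalfPow (2 * i)) (hilbertSeries d) := by
  rw [hilbertRatio, ← hilbertUnit_val, mul_assoc, Units.inv_mul, mul_one]

theorem rescale_qHalfPow (i j : ℤ) (F : PowerSeries (LaurentSeries ℤ)) :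
    PowerSeries.rescale (qHalfPow i) (PowerSeries.rescale (qHalfPow j) F) =
      PowerSeries.rescale (qHalfPow (i + j)) F := by
  rw [PowerSeries.rescale_rescale, add_comm, qHalfPow_add]

theorem hilbertRatio_zero (d : ℕ) : hilbertRatio d 0 = 1 := by
  rw [hilbertRatio, mul_zero, qHalfPow_zero, PowerSeries.rescale_one, RingHom.id_apply,
    ← hilbertUnit_val, Units.mul_inv]

theorem hilbertRatio_add (d : ℕ) (i j : ℤ) : hilbertRatio d (i + j) =
    hilbertRatio d i * PowerSeries.rescale (qHalfPow (2 * i)) (hilbertRatio d j) := by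
  rw [← (hilbertUnit d).mul_left_inj, hilbertUnit_val, hilbertRatio_mul, mul_right_comm,
    hilbertRatio_mul, ← map_mul, mul_comm (hilbertSeries d), hilbertRatio_mul, rescale_qHalfPow, mul_add]

theorem hilbertRatio_eq (d : ℕ) (i : ℤ) : hilbertRatio d i = hilbertRatio d (i + 1) +
    PowerSeries.C (signedPow (1 - d) * qHalfPow (2 * i)) * PowerSeries.X *
      hilbertRatio d (i + (1 - d)) := by
  rw [← (hilbertUnit d).mul_left_inj, hilbertUnit_val, add_mul, mul_assoc, hilbertRatio_mul,
    hilbertRatio_mul, hilbertRatio_mul]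
  conv_lhs => rw [hilbertSeries_eq]
  rw [map_add, map_mul, map_mul, rescale_qHalfPow, rescale_qHalfPow, PowerSeries.rescale_C,
    PowerSeries.rescale_X, mul_add, mul_add, mul_one, map_mul]
  ring

theorem laurentIncl_signedPow (e i : ℤ) : laurentIncl (LaurentPolynomial.C
    ((e.negOnePow : ℤˣ) : ℤ) * LaurentPolynomial.T (e + 2 * i)) =
      signedPow e * qHalfPow (2 * i) := by
  rw [laurentIncl_C_mul_T, signedPow, qHalfPow, HahnSeries.single_mul_single, mul_one]

/-- In degree n + 1, consecutive ratios differ by a Laurent monomial times a coefficient of degree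
n. Telescoping in both directions from index 0, where the ratio is 1, therefore never meets a
denominator. The shift by 1 - d forces all i to be treated together. -/
theorem coeff_hilbertRatio_mem (d n : ℕ) (i : ℤ) :
    PowerSeries.coeff n (hilbertRatio d i) ∈ laurentIncl.range := by
  induction n generalizing i with
  | zero =>
    have : PowerSeries.coeff 0 (hilbertRatio d i) = 1 := by
      have h := congrArg PowerSeries.constantCoeff (hilbertRatio_mul d i)
      rw [map_mul, constantCoeff_hilbertSeries, mul_one,
        ← PowerSeries.coeff_zero_eq_constantCoeff_apply,
        ← PowerSeries.coeff_zero_eq_constantCoeff_apply, PowerSeries.coeff_rescale, pow_zero,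
        one_mul, PowerSeries.coeff_zero_eq_constantCoeff_apply (hilbertSeries d),
        constantCoeff_hilbertSeries] at h
      exact h
    rw [this]
    exact one_mem _
  | succ n ih =>
    have step : ∀ i, PowerSeries.coeff (n + 1) (hilbertRatio d i) -
        PowerSeries.coeff (n + 1) (hilbertRatio d (i + 1)) ∈ laurentIncl.range := by
      intro i
      rw [hilbertRatio_eq d i, map_add, add_sub_cancel_left, mul_assoc, PowerSeries.coeff_C_mul,
        PowerSeries.coeff_succ_X_mul, ← laurentIncl_signedPow]
      exact mul_mem ⟨_, rfl⟩ (ih _)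
    induction i with
    | zero =>
      rw [hilbertRatio_zero, PowerSeries.coeff_one, if_neg n.succ_ne_zero]
      exact zero_mem _
    | succ k hk => simpa using sub_mem hk (step k)
    | pred k hk =>
      have := step (-(k : ℤ) - 1)
      rw [sub_add_cancel] at this
      simpa using add_mem this hk

theorem map_laurentIncl_injective :
    Function.Injective (PowerSeries.map laurentIncl) :=
  PowerSeries.map_injective _ laurentIncl_injective

theorem hilbertUnit_mem (d : ℕ) : hilbertUnit d ∈ admissible := by
  have : ∀ i, ∃ G, PowerSeries.map laurentIncl G = hilbertRatio d i := by
    intro i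
    choose g hg using fun n => coeff_hilbertRatio_mem d n i
    exact ⟨PowerSeries.mk g, PowerSeries.ext fun n => by simpa using hg n⟩
  choose ρ hρ using this
  have h0 : ρ 0 = 1 := map_laurentIncl_injective (by rw [hρ, hilbertRatio_zero, map_one])
  have hadd : ∀ i j, ρ (i + j) =
      ρ i * PowerSeries.rescale (LaurentPolynomial.T (2 * i)) (ρ j) := fun i j =>
    map_laurentIncl_injective (by
      rw [hρ, map_mul, ← PowerSeries.rescale_map, hρ, hρ, laurentIncl_T, hilbertRatio_add])
  have hrec : ∀ i, ρ i = ρ (i + 1) + PowerSeries.C (LaurentPolynomial.C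
      (((1 - d : ℤ).negOnePow : ℤˣ) : ℤ) * LaurentPolynomial.T ((1 - d : ℤ) + 2 * i)) *
        PowerSeries.X * ρ (i + (1 - d)) := fun i =>
    map_laurentIncl_injective (by
      rw [hρ, map_add, map_mul, map_mul, PowerSeries.map_C, PowerSeries.map_X, hρ, hρ,
        laurentIncl_signedPow, hilbertRatio_eq])
  have hunit : IsUnit (ρ 1) := by
    refine IsUnit.of_mul_eq_one (PowerSeries.rescale (LaurentPolynomial.T (2 * 1)) (ρ (-1))) ?_
    rw [← hadd, add_neg_cancel, h0]
  rw [mem_admissible]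
  refine ⟨hunit.unit, mem_rootCompatible.2 fun N t ht => ?_, ?_⟩
  · exact rootNorm_eq_powerTwist_of_cocycle h0 hadd hrec ht
  · rw [IsUnit.unit_spec, hρ, hilbertUnit_val, hilbertRatio_mul, mul_one]

/-! ### Calculus of leading terms 1 + a z^n -/

namespace PowerSeries

variable {S : Type*} [CommRing S]

/-- `F ≡ 1 + a z ^ n` modulo `z ^ (n + 1)`. -/
def IsOneAdd (n : ℕ) (F : PowerSeries S) (a : S) : Prop :=
  X ^ (n + 1) ∣ F - (1 + C a * X ^ n)

theorem coeff_one_add {n : ℕ} (hn : n ≠ 0) (a : S) (k : ℕ) :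
    coeff k (1 + C a * X ^ n) = if k = n then a else coeff k (1 : PowerSeries S) := by
  rw [map_add, coeff_C_mul, coeff_X_pow, coeff_one]
  split_ifs with h1 h2 <;> simp_all

theorem isOneAdd_iff {n : ℕ} (hn : n ≠ 0) {F : PowerSeries S} {a : S} :
    IsOneAdd n F a ↔ (∀ k < n, coeff k F = coeff k (1 : PowerSeries S)) ∧ coeff n F = a := by
  rw [IsOneAdd, X_pow_dvd_iff]
  constructor
  · intro h
    refine ⟨fun k hk => ?_, ?_⟩
    · have := h k (by omega)
      rwa [map_sub, coeff_one_add hn a, if_neg hk.ne, sub_eq_zero] at this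
    · have := h n (by omega)
      rwa [map_sub, coeff_one_add hn a, if_pos rfl, sub_eq_zero] at this
  · rintro ⟨h, rfl⟩ k hk
    rw [map_sub, coeff_one_add hn, sub_eq_zero]
    split_ifs with hkn
    · rw [hkn]
    · exact h k (by omega)

theorem isOneAdd_of_dvd {n : ℕ} (hn : n ≠ 0) {F : PowerSeries S} (h : X ^ n ∣ F - 1) :
    IsOneAdd n F (coeff n F) :=
  (isOneAdd_iff hn).2 ⟨fun k hk => sub_eq_zero.1 (by
    rw [← map_sub]; exact X_pow_dvd_iff.1 h k hk), rfl⟩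

theorem isOneAdd_one (n : ℕ) : IsOneAdd n (1 : PowerSeries S) 0 := by
  simp [IsOneAdd]

theorem IsOneAdd.dvd {n : ℕ} {F : PowerSeries S} {a : S} (h : IsOneAdd n F a) :
    X ^ n ∣ F - 1 := by
  have h1 : (X : PowerSeries S) ^ n ∣ F - (1 + C a * X ^ n) :=
    (pow_dvd_pow _ n.le_succ).trans h
  have := dvd_add h1 (Dvd.intro_left (C a) rfl)
  rwa [← sub_sub, sub_add_cancel] at this

theorem IsOneAdd.dvd_of_eq_zero {n : ℕ} {F : PowerSeries S} (h : IsOneAdd n F 0) :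
    X ^ (n + 1) ∣ F - 1 := by
  simpa [IsOneAdd] using h

theorem X_pow_succ_dvd_two {n : ℕ} (hn : n ≠ 0) :
    (X : PowerSeries S) ^ (n + 1) ∣ X ^ n * X ^ n := by
  rw [← pow_add]
  exact pow_dvd_pow _ (by omega)

theorem IsOneAdd.mul {n : ℕ} (hn : n ≠ 0) {F G : PowerSeries S} {a b : S} (hF : IsOneAdd n F a)
    (hG : IsOneAdd n G b) : IsOneAdd n (F * G) (a + b) := by
  have := dvd_add (dvd_add (hG.mul_left F) (hF.mul_right (1 + C b * X ^ n)))
    ((X_pow_succ_dvd_two hn).mul_left (C a * C b))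
  refine this.trans (dvd_of_eq ?_)
  rw [map_add]
  ring

theorem IsOneAdd.inv {n : ℕ} (hn : n ≠ 0) {F : (PowerSeries S)ˣ} {a : S}
    (hF : IsOneAdd n (F : PowerSeries S) a) :
    IsOneAdd n ((F⁻¹ : (PowerSeries S)ˣ) : PowerSeries S) (-a) := by
  have := ((dvd_sub ((X_pow_succ_dvd_two hn).mul_left (C a * C a))
    (hF.mul_right (1 - C a * X ^ n)))).mul_left ((F⁻¹ : (PowerSeries S)ˣ) : PowerSeries S)
  refine this.trans (dvd_of_eq ?_)
  rw [map_neg]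
  linear_combination (C a * X ^ n - 1) * F.inv_mul

theorem IsOneAdd.zpow {n : ℕ} (hn : n ≠ 0) {F : (PowerSeries S)ˣ} {a : S}
    (hF : IsOneAdd n (F : PowerSeries S) a) (k : ℤ) :
    IsOneAdd n ((F ^ k : (PowerSeries S)ˣ) : PowerSeries S) (k * a) := by
  induction k with
  | zero => simpa using isOneAdd_one n
  | succ k ih =>
    have := ih.mul hn hF
    rw [zpow_add_one, Units.val_mul]
    push_cast at this ⊢
    rwa [add_mul, one_mul]
  | pred k ih =>
    have := ih.mul hn (hF.inv hn)
    rw [zpow_sub_one, Units.val_mul]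
    push_cast at this ⊢
    rwa [sub_mul, one_mul, sub_eq_add_neg]

theorem IsOneAdd.prod {ι : Type*} {n : ℕ} (hn : n ≠ 0) (s : Finset ι) {F : ι → PowerSeries S}
    {a : ι → S} (hF : ∀ i ∈ s, IsOneAdd n (F i) (a i)) :
    IsOneAdd n (∏ i ∈ s, F i) (∑ i ∈ s, a i) := by
  classical
  induction s using Finset.induction_on with
  | empty => simpa using isOneAdd_one n
  | insert i s hi ih =>
    rw [Finset.prod_insert hi, Finset.sum_insert hi]
    exact (hF i (Finset.mem_insert_self i s)).mul hn
      (ih fun j hj => hF j (Finset.mem_insert_of_mem hj))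

theorem IsOneAdd.map {S' : Type*} [CommRing S'] (φ : S →+* S') {n : ℕ} {F : PowerSeries S} {a : S}
    (hF : IsOneAdd n F a) : IsOneAdd n (PowerSeries.map φ F) (φ a) := by
  have := map_dvd (PowerSeries.map φ) hF
  simpa [IsOneAdd] using this

theorem IsOneAdd.rescale (c : S) {n : ℕ} {F : PowerSeries S} {a : S}
    (hF : IsOneAdd n F a) : IsOneAdd n (PowerSeries.rescale c F) (c ^ n * a) := by
  have := map_dvd (PowerSeries.rescale c) hF
  rw [map_pow, rescale_X, mul_pow] at this
  refine (Dvd.intro_left _ rfl).trans (this.trans (dvd_of_eq ?_))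
  rw [map_sub, map_add, map_one, map_mul, PowerSeries.rescale_C, map_pow, rescale_X, map_mul,
    map_pow]
  ring

end PowerSeries

/-! ### Integrality of the exponents -/

-- The divisor (t^(2n) - 1) / (t² - 1) is monic, so divisibility may be tested over ℂ; there it is
-- separable, so its roots suffice.
open Polynomial in
theorem expand_geomSum_dvd_of_roots {n : ℕ} (hn : n ≠ 0) {p : ℤ[X]}
    (hp : ∀ t : ℂ, t ^ (2 * n) = 1 → t ^ 2 ≠ 1 → aeval t p = 0) :
    expand ℤ 2 (∑ i ∈ Finset.range n, X ^ i) ∣ p := by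
  have hm : (expand ℤ 2 (∑ i ∈ Finset.range n, X ^ i)).Monic :=
    (monic_geom_sum_X hn).expand two_pos
  rw [← map_dvd_map (Int.castRingHom ℂ) Int.cast_injective hm]
  set D := (expand ℤ 2 (∑ i ∈ Finset.range n, X ^ i)).map (Int.castRingHom ℂ) with hD
  have hmul : D * (X ^ 2 - 1) = X ^ (2 * n) - 1 := by
    have := congrArg (fun g => (expand ℤ 2 g).map (Int.castRingHom ℂ)) (geom_sum_mul (X : ℤ[X]) n)
    rw [map_mul, Polynomial.map_mul] at this
    refine Eq.trans ?_ (this.trans ?_)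
    · rw [hD]; congr 1; simp
    · simp [← pow_mul]
  have hsep : (X ^ (2 * n) - 1 : ℂ[X]).Separable :=
    (X_pow_sub_one_separable_iff (F := ℂ)).2 (by exact_mod_cast (by omega : 2 * n ≠ 0))
  have hDsep : D.Separable := hsep.of_dvd ⟨_, hmul.symm⟩
  rcases eq_or_ne (p.map (Int.castRingHom ℂ)) 0 with h0 | h0
  · rw [h0]; exact dvd_zero _
  have hsub : D.roots ≤ (p.map (Int.castRingHom ℂ)).roots := by
    rw [Multiset.le_iff_subset (nodup_roots hDsep)]
    intro t ht
    have hDt : D.eval t = 0 := (mem_roots'.1 ht).2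
    rw [mem_roots h0, IsRoot.def, eval_map, ← algebraMap_int_eq, ← aeval_def]
    refine hp t ?_ fun h2 => ?_
    · have := congrArg (eval t) hmul
      rw [eval_mul, hDt, zero_mul] at this
      rw [eval_sub, eval_pow, eval_X, eval_one] at this
      exact (sub_eq_zero.1 this.symm)
    -- At t² = 1 the divisor takes the value n, which is not 0.
    · rw [hD, map_expand, expand_eval, h2] at hDt
      simp [eval_finsetSum] at hDt
      exact hn hDt
  exact (IsAlgClosed.splits D).dvd_of_roots_le_roots (hm.map _).ne_zero hsub

theorem exists_laurentIncl_eq {F : (PowerSeries (LaurentSeries ℤ))ˣ} (hF : F ∈ admissible)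
    {n : ℕ} (hn : n ≠ 0) {a : LaurentSeries ℤ}
    (ha : PowerSeries.IsOneAdd n (F : PowerSeries (LaurentSeries ℤ)) a) :
    ∃ f, laurentIncl f = a * (qHalfPow 2 - 1) := by
  obtain ⟨G, hG, hGF⟩ := mem_admissible.1 hF
  have hG1 : PowerSeries.IsOneAdd n (PowerSeries.map laurentIncl (G : PowerSeries ℤ[T;T⁻¹]))
      (qHalfPow 2 ^ n * a + -a) := by
    have := (ha.rescale (qHalfPow 2)).mul hn (ha.inv hn)
    rwa [← hGF, mul_assoc, Units.mul_inv, mul_one] at this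
  obtain ⟨hlow, hb⟩ := (PowerSeries.isOneAdd_iff hn).1 hG1
  set b := PowerSeries.coeff n (G : PowerSeries ℤ[T;T⁻¹]) with hbdef
  have hGlow : ∀ k < n, PowerSeries.coeff k (G : PowerSeries ℤ[T;T⁻¹]) =
      PowerSeries.coeff k (1 : PowerSeries ℤ[T;T⁻¹]) := by
    intro k hk
    apply laurentIncl_injective
    rw [← PowerSeries.coeff_map, hlow k hk, ← PowerSeries.coeff_map,
      map_one (PowerSeries.map laurentIncl)]
  have hGb : PowerSeries.IsOneAdd n (G : PowerSeries ℤ[T;T⁻¹]) b :=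
    (PowerSeries.isOneAdd_iff hn).2 ⟨hGlow, rfl⟩
  -- Let N be the order of t², so N ∣ n and N > 1. In degree n the norm has coefficient N b(t),
  -- since each q^(i n) is 1; the twist has a coefficient coming from degree n / N of G, strictly
  -- between 0 and n, where G vanishes.
  have hroot : ∀ t : ℂˣ, t ^ (2 * n) = 1 → t ^ 2 ≠ 1 → laurentEval t b = 0 := by
    intro t ht ht1
    have hpos : 0 < orderOf (t ^ 2) :=
      orderOf_pos_iff.2 (isOfFinOrder_iff_pow_eq_one.2 ⟨n, Nat.pos_of_ne_zero hn, by rwa [← pow_mul]⟩)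
    set N : ℕ+ := ⟨orderOf (t ^ 2), hpos⟩ with hN
    have hNn : (N : ℕ) ∣ n := orderOf_dvd_of_pow_eq_one (by rwa [← pow_mul])
    have hN1 : 1 < (N : ℕ) := by
      have : (N : ℕ) ≠ 1 := fun h => ht1 (orderOf_eq_one_iff.1 h)
      have := N.pos
      omega
    have hprim : IsPrimitiveRoot ((t : ℂ) ^ 2) N := by
      rw [← Units.val_pow_eq_pow_val]
      exact IsPrimitiveRoot.coe_units_iff.2 (IsPrimitiveRoot.orderOf (t ^ 2))
    have heq := mem_rootCompatible.1 hG N t hprim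
    have hL : PowerSeries.IsOneAdd n (rootNorm N t G)
        (∑ i ∈ Finset.range N, ((t : ℂ) ^ (2 * i)) ^ n * laurentEval t b) := by
      rw [rootNorm_apply]
      exact PowerSeries.IsOneAdd.prod hn _ fun i _ => (hGb.map _).rescale _
    have hone : ∀ i, ((t : ℂ) ^ (2 * i)) ^ n = 1 := by
      intro i
      rw [← pow_mul, mul_right_comm, pow_mul, ← Units.val_pow_eq_pow_val, ht, Units.val_one,
        one_pow]
    simp only [hone, one_mul, Finset.sum_const, Finset.card_range] at hL
    have hc := ((PowerSeries.isOneAdd_iff hn).1 hL).2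
    obtain ⟨k, hk⟩ := hNn
    have hk0 : k ≠ 0 := by rintro rfl; exact hn (by simpa using hk)
    have hkn : k < n := by rw [hk]; exact lt_mul_of_one_lt_left (Nat.pos_of_ne_zero hk0) hN1
    rw [heq, powerTwist_apply, hk, PowerSeries.coeff_expand_mul, PowerSeries.coeff_map, hGlow k hkn,
      PowerSeries.coeff_one, if_neg hk0, map_zero, eq_comm, nsmul_eq_mul] at hc
    exact (mul_eq_zero.1 hc).resolve_left (by exact_mod_cast N.ne_zero)
  -- A power of T clears the negative exponents, so that polynomial divisibility applies.
  obtain ⟨j, p, hp⟩ := LaurentPolynomial.exists_T_pow b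
  have hev : ∀ t : ℂˣ, laurentEval t (Polynomial.toLaurent p) = Polynomial.aeval (t : ℂ) p := by
    intro t
    rw [laurentEval, LaurentPolynomial.eval₂_toLaurent, Polynomial.aeval_def]
    rfl
  obtain ⟨g, hg⟩ := expand_geomSum_dvd_of_roots hn (p := p) (by
    intro t ht ht1
    have ht0 : t ≠ 0 := by
      rintro rfl
      rw [zero_pow (by omega)] at ht
      exact zero_ne_one ht
    have := hev (Units.mk0 t ht0)
    rw [hp, map_mul, hroot (Units.mk0 t ht0) (Units.ext (by simpa using ht))
      (fun h => ht1 (by simpa using congrArg Units.val h)), zero_mul] at this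
    simpa using this.symm)
  have hD := congrArg (fun g => laurentIncl (Polynomial.toLaurent (Polynomial.expand ℤ 2 g)))
    (geom_sum_mul (Polynomial.X : Polynomial ℤ) n)
  set D := Polynomial.expand ℤ 2 (∑ i ∈ Finset.range n, Polynomial.X ^ i)
  have hX : laurentIncl (Polynomial.toLaurent (Polynomial.expand ℤ 2 Polynomial.X)) =
      qHalfPow 2 := by
    rw [Polynomial.expand_X, Polynomial.toLaurent_X_pow, laurentIncl_T]
    rfl
  simp only [map_mul, map_sub, map_pow, map_one, hX] at hD
  have hD0 : laurentIncl (Polynomial.toLaurent D) ≠ 0 := by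
    intro h0
    rw [h0, zero_mul, qHalfPow_two_pow] at hD
    exact one_sub_qHalfPow_ne_zero (m := 2 * n) (by omega) (by linear_combination hD)
  refine ⟨Polynomial.toLaurent g * LaurentPolynomial.T (-(j : ℤ)), mul_left_cancel₀ hD0 ?_⟩
  have hbg : Polynomial.toLaurent D * (Polynomial.toLaurent g * LaurentPolynomial.T (-(j : ℤ))) =
      b := by
    rw [← mul_assoc, ← map_mul, ← hg, hp, mul_assoc, ← LaurentPolynomial.T_add, add_neg_cancel,
      LaurentPolynomial.T_zero, mul_one]
  rw [← map_mul, hbg, hbdef, ← PowerSeries.coeff_map, hb]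
  linear_combination -a * hD

/-! ### Parity -/

/-- The substitution `q^{1/2} ↦ -q^{1/2}`. -/
noncomputable def flipSign : LaurentSeries ℤ →+* LaurentSeries ℤ where
  toFun f :=
    { coeff := fun m => (m.negOnePow : ℤ) * f.coeff m
      isPWO_support' := f.isPWO_support.mono fun m hm => right_ne_zero_of_mul hm }
  map_one' := by
    ext m
    change (m.negOnePow : ℤ) * (1 : LaurentSeries ℤ).coeff m = (1 : LaurentSeries ℤ).coeff m
    rw [HahnSeries.coeff_one]
    split_ifs with h
    · rw [h, Int.negOnePow_zero]; rfl
    · rw [mul_zero]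
  map_zero' := by
    ext m
    exact mul_zero _
  map_add' f g := by
    ext m
    exact mul_add _ _ _
  map_mul' f g := by
    ext m
    change (m.negOnePow : ℤ) * (f * g).coeff m = _
    rw [HahnSeries.coeff_mul, HahnSeries.coeff_mul, Finset.mul_sum]
    refine Finset.sum_congr (Finset.ext fun ij => ?_) fun ij hij => ?_
    · simp
    · rw [← (Finset.mem_antidiagonal.1 hij).2.2, Int.negOnePow_add, Units.val_mul]
      exact mul_mul_mul_comm _ _ _ _

theorem coeff_flipSign (f : LaurentSeries ℤ) (m : ℤ) :
    (flipSign f).coeff m = (m.negOnePow : ℤ) * f.coeff m := rfl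

theorem flipSign_single (m a : ℤ) :
    flipSign (HahnSeries.single m a) = (m.negOnePow : ℤ) • HahnSeries.single m a := by
  ext k
  rw [coeff_flipSign, HahnSeries.coeff_smul, HahnSeries.coeff_single, smul_eq_mul]
  split_ifs with h
  · rw [h]
  · rw [mul_zero, mul_zero]

theorem flipSign_qHalfPow_two : flipSign (qHalfPow 2) = qHalfPow 2 := by
  rw [qHalfPow, flipSign_single, Int.negOnePow_even 2 even_two, Units.val_one, one_smul]

/-- The units `F` of `ℤ((q^{1/2}))⟦z⟧` that are invariant under
`q^{1/2} ↦ -q^{1/2}`, `z ↦ (-1) ^ (d - 1) z`. -/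
noncomputable def parityInvariant (d : ℕ) : Subgroup (PowerSeries (LaurentSeries ℤ))ˣ :=
  (Units.map (PowerSeries.map flipSign :
      PowerSeries (LaurentSeries ℤ) →* PowerSeries (LaurentSeries ℤ))).eqLocus
    (Units.map (PowerSeries.rescale ((-1 : LaurentSeries ℤ) ^ (d + 1)) :
      PowerSeries (LaurentSeries ℤ) →* PowerSeries (LaurentSeries ℤ)))

theorem mem_parityInvariant {d : ℕ} {F : (PowerSeries (LaurentSeries ℤ))ˣ} :
    F ∈ parityInvariant d ↔
      ∀ n, flipSign (PowerSeries.coeff n (F : PowerSeries (LaurentSeries ℤ))) =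
        ((-1) ^ (d + 1)) ^ n * PowerSeries.coeff n (F : PowerSeries (LaurentSeries ℤ)) := by
  refine Units.ext_iff.trans (PowerSeries.ext_iff.trans (forall_congr' fun n => ?_))
  rw [← PowerSeries.coeff_map, ← PowerSeries.coeff_rescale]
  rfl

/-- The quotient of two solutions is invariant under z ↦ qz, hence constant because q^k ≠ 1 for k >
0. -/
theorem eq_of_eq_mul_rescale {W F F' : PowerSeries (LaurentSeries ℤ)}
    (h1 : PowerSeries.constantCoeff F = 1) (h1' : PowerSeries.constantCoeff F' = 1)
    (h : F = W * PowerSeries.rescale (qHalfPow 2) F)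
    (h' : F' = W * PowerSeries.rescale (qHalfPow 2) F') : F = F' := by
  obtain ⟨V, hV⟩ := isUnit_of_constantCoeff_eq_one h1'
  have hmul : F * PowerSeries.rescale (qHalfPow 2) F' = F' * PowerSeries.rescale (qHalfPow 2) F := by
    conv_lhs => rw [h]
    conv_rhs => rw [h']
    ring
  set U := F * ((V⁻¹ : (PowerSeries (LaurentSeries ℤ))ˣ) : PowerSeries (LaurentSeries ℤ)) with hU
  have hFU : F = U * F' := by rw [hU, ← hV, mul_assoc, Units.inv_mul, mul_one]
  have hres : PowerSeries.rescale (qHalfPow 2) U = U := by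
    have hu : IsUnit (F' * PowerSeries.rescale (qHalfPow 2) F') :=
      IsUnit.mul ⟨V, hV⟩ (RingHom.isUnit_map _ ⟨V, hV⟩)
    apply hu.mul_left_cancel
    rw [hFU, map_mul] at hmul
    linear_combination -hmul
  have hU1 : U = 1 := by
    ext1 k
    have hk := congrArg (PowerSeries.coeff k) hres
    rw [PowerSeries.coeff_rescale, qHalfPow_two_pow] at hk
    rw [PowerSeries.coeff_one]
    split_ifs with h0
    · have := congrArg PowerSeries.constantCoeff hFU
      rw [map_mul, h1, h1', mul_one] at this
      rw [h0, PowerSeries.coeff_zero_eq_constantCoeff_apply, this]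
    · refine (mul_eq_zero.1 (?_ : (1 - qHalfPow (2 * k)) * _ = 0)).resolve_left
        (one_sub_qHalfPow_ne_zero (by omega))
      linear_combination -hk
  rw [hFU, hU1, one_mul]

theorem negOnePow_eq_pow {d n : ℕ} {m : ℤ} (h : (2 : ℤ) ∣ m - ((d : ℤ) - 1) * n) :
    ((m.negOnePow : ℤˣ) : ℤ) = ((-1) ^ (d + 1)) ^ n := by
  obtain ⟨k, hk⟩ := h
  have : m = (((d + 1) * n : ℕ) : ℤ) + 2 * (k - n) := by push_cast; linear_combination hk
  rw [this, Int.negOnePow_add, Int.negOnePow_two_mul, mul_one, ← pow_mul]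
  rw [Int.negOnePow_def, zpow_natCast]
  simp

theorem dvd_of_negOnePow_eq_pow {d n : ℕ} {m : ℤ}
    (h : ((m.negOnePow : ℤˣ) : ℤ) = ((-1) ^ (d + 1)) ^ n) : (2 : ℤ) ∣ m - ((d : ℤ) - 1) * n := by
  have h1 : (((((d : ℤ) - 1) * n).negOnePow : ℤˣ) : ℤ) = ((-1) ^ (d + 1)) ^ n :=
    negOnePow_eq_pow (by simp)
  have := (Int.negOnePow_eq_iff _ _).1 (Units.ext (h.trans h1.symm))
  exact this.two_dvd

/-- Both substitutions yield normalised solutions of one q-difference equation, so only its finite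
factor has to be compared and no continuity is needed. -/
theorem pochhammerUnit_mem_parityInvariant {d : ℕ} {n : ℕ+} {m : ℤ}
    (h : (2 : ℤ) ∣ m - ((d : ℤ) - 1) * (n : ℕ)) : pochhammerUnit n m ∈ parityInvariant d := by
  refine Units.ext ?_
  change PowerSeries.map flipSign (qPochhammerInf (qzMonomial n m)) =
    PowerSeries.rescale ((-1 : LaurentSeries ℤ) ^ (d + 1)) (qPochhammerInf (qzMonomial n m))
  have hK := qPochhammerInf_eq_prod_mul n n.ne_zero m
  have h1 := constantCoeff_qPochhammerInf n n.ne_zero m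
  have hf : PowerSeries.map flipSign
      (∏ i ∈ Finset.range n, qPochhammerFactor (qzMonomial n m) i) =
    PowerSeries.rescale ((-1 : LaurentSeries ℤ) ^ (d + 1))
      (∏ i ∈ Finset.range n, qPochhammerFactor (qzMonomial n m) i) := by
    rw [map_prod, map_prod]
    refine Finset.prod_congr rfl fun i _ => ?_
    rw [qPochhammerFactor, map_sub, map_sub, map_one, map_one, map_mul, map_mul,
      PowerSeries.map_C, map_pow, flipSign_qHalfPow_two, PowerSeries.rescale_C, qzMonomial,
      PowerSeries.monomial_eq_C_mul_X_pow, map_mul, map_mul, map_pow, map_pow, PowerSeries.map_X,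
      map_pow (PowerSeries.rescale _) PowerSeries.X, PowerSeries.rescale_X,
      PowerSeries.map_C, PowerSeries.rescale_C, qHalfPow.eq_1 m,
      flipSign_single, negOnePow_eq_pow h, zsmul_eq_mul, mul_pow]
    push_cast
    simp only [map_mul, map_pow, map_neg, map_one]
    ring
  refine eq_of_eq_mul_rescale (W := PowerSeries.map flipSign
      (∏ i ∈ Finset.range n, qPochhammerFactor (qzMonomial n m) i)) ?_ ?_ ?_ ?_
  · rw [← PowerSeries.coeff_zero_eq_constantCoeff_apply, PowerSeries.coeff_map,
      PowerSeries.coeff_zero_eq_constantCoeff_apply, h1, map_one]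
  · rw [← PowerSeries.coeff_zero_eq_constantCoeff_apply, PowerSeries.coeff_rescale, pow_zero,
      one_mul, PowerSeries.coeff_zero_eq_constantCoeff_apply, h1]
  · conv_lhs => rw [hK]
    rw [map_mul, ← PowerSeries.rescale_map, flipSign_qHalfPow_two]
  · conv_lhs => rw [hK]
    rw [hf, map_mul, PowerSeries.rescale_rescale, PowerSeries.rescale_rescale, mul_comm (qHalfPow 2)]

theorem flipSign_hilbertCoeff (d n : ℕ) : flipSign (hilbertCoeff d n) =
    ((-1) ^ (d + 1)) ^ n * hilbertCoeff d n := by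
  apply mul_right_cancel₀ (prod_one_sub_ne_zero n)
  have h := congrArg flipSign (hilbertCoeff_mul_prod d n)
  have hD : flipSign (∏ i ∈ Finset.Icc 1 n, (1 - qHalfPow 2 ^ i)) =
      ∏ i ∈ Finset.Icc 1 n, (1 - qHalfPow 2 ^ i) := by
    simp only [map_prod, map_sub, map_one, map_pow, flipSign_qHalfPow_two]
  -- The exponent (1 - d) n² has the parity of (d - 1) n because n² ≡ n modulo 2.
  have hsq : (2 : ℤ) ∣ (n : ℤ) ^ 2 - n := by
    have := Int.even_mul_pred_self n
    rw [pow_two, ← mul_sub_one]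
    exact this.two_dvd
  rw [map_mul, hD, flipSign_single, ← hilbertCoeff_mul_prod, negOnePow_eq_pow (d := d) (n := n),
    zsmul_eq_mul] at h
  · rw [h]
    push_cast
    ring
  · obtain ⟨k, hk⟩ := hsq
    exact ⟨(1 - d) * k - (d - 1) * n, by linear_combination (1 - (d : ℤ)) * hk⟩

theorem hilbertUnit_mem_parityInvariant (d : ℕ) : hilbertUnit d ∈ parityInvariant d := by
  rw [mem_parityInvariant]
  intro n
  rw [hilbertUnit_val, hilbertSeries, PowerSeries.coeff_mk, flipSign_hilbertCoeff]

/-! ### Splitting off the factors degree by degree -/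

theorem isOneAdd_pochhammerUnit (n : ℕ+) (m : ℤ) : PowerSeries.IsOneAdd n
    (pochhammerUnit n m : PowerSeries (LaurentSeries ℤ))
    (PowerSeries.coeff n (qPochhammerInf (qzMonomial n m))) := by
  refine (PowerSeries.isOneAdd_iff n.ne_zero).2 ⟨fun k hk => ?_, rfl⟩
  rw [pochhammerUnit_val, PowerSeries.coeff_one]
  split_ifs with h
  · rw [h, PowerSeries.coeff_zero_eq_constantCoeff_apply,
      constantCoeff_qPochhammerInf n n.ne_zero]
  · exact coeff_qPochhammerInf_of_lt n n.ne_zero m h hk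

/-- The finite product `∏_m (q^{m/2} z ^ n; q)_∞ ^ {f_m}`. -/
noncomputable def pochhammerProd (n : ℕ+) (f : ℤ[T;T⁻¹]) : (PowerSeries (LaurentSeries ℤ))ˣ :=
  ∏ m ∈ f.coeff.support, pochhammerUnit n m ^ f.coeff m

theorem laurentIncl_eq_sum (f : ℤ[T;T⁻¹]) :
    laurentIncl f = ∑ m ∈ f.coeff.support, (f.coeff m : LaurentSeries ℤ) * qHalfPow m := by
  ext k
  rw [coeff_laurentIncl, HahnSeries.coeff_sum]
  simp only [← zsmul_eq_mul, HahnSeries.coeff_smul, qHalfPow, HahnSeries.coeff_single]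
  simp

/-- Leading coefficients add up: ∑ f_m (-t^m / (1 - q)) = f / (q - 1) = a. -/
theorem isOneAdd_pochhammerProd (n : ℕ+) {f : ℤ[T;T⁻¹]} {a : LaurentSeries ℤ}
    (h : laurentIncl f = a * (qHalfPow 2 - 1)) : PowerSeries.IsOneAdd n
      (pochhammerProd n f : PowerSeries (LaurentSeries ℤ)) a := by
  have hp := PowerSeries.IsOneAdd.prod n.ne_zero f.coeff.support
    fun m _ => (isOneAdd_pochhammerUnit n m).zpow n.ne_zero (f.coeff m)
  rw [← Units.coe_prod] at hp
  refine (congrArg (PowerSeries.IsOneAdd (n : ℕ) _) ?_).mpr hp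
  have h0 : qHalfPow 2 - 1 ≠ 0 := by
    rw [← neg_sub]
    exact neg_ne_zero.2 (one_sub_qHalfPow_ne_zero two_ne_zero)
  apply mul_right_cancel₀ h0
  rw [← h, laurentIncl_eq_sum, Finset.sum_mul]
  refine Finset.sum_congr rfl fun m _ => ?_
  linear_combination (f.coeff m : LaurentSeries ℤ) * coeff_qPochhammerInf_mul n n.ne_zero m

theorem exists_pochhammerProd {d : ℕ} (n : ℕ+) {F : (PowerSeries (LaurentSeries ℤ))ˣ}
    (hF : F ∈ admissible ⊓ parityInvariant d)
    (h1 : PowerSeries.X ^ (n : ℕ) ∣ (F : PowerSeries (LaurentSeries ℤ)) - 1) :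
    ∃ f : ℤ[T;T⁻¹], (∀ m, f.coeff m ≠ 0 → (2 : ℤ) ∣ m - ((d : ℤ) - 1) * (n : ℕ)) ∧
      F * (pochhammerProd n f)⁻¹ ∈ admissible ⊓ parityInvariant d ∧
      PowerSeries.X ^ ((n : ℕ) + 1) ∣
        ((F * (pochhammerProd n f)⁻¹ : (PowerSeries (LaurentSeries ℤ))ˣ) :
          PowerSeries (LaurentSeries ℤ)) - 1 := by
  have ha := PowerSeries.isOneAdd_of_dvd n.ne_zero h1
  obtain ⟨f, hf⟩ := exists_laurentIncl_eq hF.1 n.ne_zero ha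
  -- f = a (q - 1) inherits the sign rule of a, while t ↦ -t multiplies its coefficient at t^m by
  -- (-1)^m; a nonzero coefficient forces the two signs to agree.
  have hpar : ∀ m, f.coeff m ≠ 0 → (2 : ℤ) ∣ m - ((d : ℤ) - 1) * (n : ℕ) := by
    intro m hm
    apply dvd_of_negOnePow_eq_pow
    have hs : flipSign (laurentIncl f) = ((((-1) ^ (d + 1)) ^ (n : ℕ) : ℤ) : LaurentSeries ℤ) *
        laurentIncl f := by
      rw [hf, map_mul, mem_parityInvariant.1 hF.2, map_sub, flipSign_qHalfPow_two, map_one]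
      push_cast
      ring
    have hc := congrArg (fun x => x.coeff m) hs
    simp only [coeff_flipSign, ← zsmul_eq_mul, HahnSeries.coeff_smul, smul_eq_mul,
      coeff_laurentIncl] at hc
    exact mul_right_cancel₀ hm hc
  refine ⟨f, hpar, mul_mem hF (inv_mem ⟨?_, ?_⟩), ?_⟩
  · exact prod_mem fun m _ => zpow_mem (pochhammerUnit_mem n m) _
  · exact prod_mem fun m hm => zpow_mem
      (pochhammerUnit_mem_parityInvariant (hpar m (Finsupp.mem_support_iff.1 hm))) _
  · have := ha.mul n.ne_zero ((isOneAdd_pochhammerProd n hf).inv n.ne_zero)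
    rw [add_neg_cancel] at this
    exact this.dvd_of_eq_zero

theorem exists_pochhammerProd_sequence (d : ℕ) :
    ∃ (f : ℕ → ℤ[T;T⁻¹]) (F : ℕ → (PowerSeries (LaurentSeries ℤ))ˣ), F 0 = hilbertUnit d ∧
      (∀ k, F k = pochhammerProd k.succPNat (f k) * F (k + 1)) ∧
      (∀ k, PowerSeries.X ^ (k + 1) ∣ (F k : PowerSeries (LaurentSeries ℤ)) - 1) ∧
      ∀ k m, (f k).coeff m ≠ 0 → (2 : ℤ) ∣ m - ((d : ℤ) - 1) * (k.succPNat : ℕ) := by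
  have step : ∀ k (F : (PowerSeries (LaurentSeries ℤ))ˣ), ∃ f : ℤ[T;T⁻¹],
      (F ∈ admissible ⊓ parityInvariant d ∧
        PowerSeries.X ^ (k + 1) ∣ (F : PowerSeries (LaurentSeries ℤ)) - 1) →
      (∀ m, f.coeff m ≠ 0 → (2 : ℤ) ∣ m - ((d : ℤ) - 1) * (k.succPNat : ℕ)) ∧
      F * (pochhammerProd k.succPNat f)⁻¹ ∈ admissible ⊓ parityInvariant d ∧
      PowerSeries.X ^ (k + 1 + 1) ∣
        ((F * (pochhammerProd k.succPNat f)⁻¹ : (PowerSeries (LaurentSeries ℤ))ˣ) :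
          PowerSeries (LaurentSeries ℤ)) - 1 := by
    intro k F
    by_cases h : F ∈ admissible ⊓ parityInvariant d ∧
        PowerSeries.X ^ (k + 1) ∣ (F : PowerSeries (LaurentSeries ℤ)) - 1
    · obtain ⟨f, hf⟩ := exists_pochhammerProd k.succPNat h.1 h.2
      exact ⟨f, fun _ => hf⟩
    -- A dummy value makes the choice of f total in F, so that F k can be defined by recursion
    -- before its invariants are known.
    · exact ⟨0, fun h' => absurd h' h⟩
  choose g hg using step
  let F : ℕ → (PowerSeries (LaurentSeries ℤ))ˣ := fun k =>
    Nat.rec (hilbertUnit d) (fun k F => F * (pochhammerProd k.succPNat (g k F))⁻¹) k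
  have hF : ∀ k, F k ∈ admissible ⊓ parityInvariant d ∧
      PowerSeries.X ^ (k + 1) ∣ Units.val (F k) - 1 := by
    intro k
    induction k with
    | zero =>
      refine ⟨⟨hilbertUnit_mem d, hilbertUnit_mem_parityInvariant d⟩, ?_⟩
      rw [zero_add, pow_one, PowerSeries.X_dvd_iff, map_sub, map_one]
      exact sub_eq_zero.2 (constantCoeff_hilbertSeries d)
    | succ k ih => exact (hg k (F k) ih).2
  refine ⟨fun k => g k (F k), F, rfl, fun k => ?_, fun k => (hF k).2, fun k => (hg k _ (hF k)).1⟩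
  change F k = pochhammerProd k.succPNat (g k (F k)) *
    (F k * (pochhammerProd k.succPNat (g k (F k)))⁻¹)
  rw [mul_comm, inv_mul_cancel_right]

theorem seriesZPow_val (F : (PowerSeries (LaurentSeries ℤ))ˣ) (k : ℤ) :
    seriesZPow F k = ((F ^ k : (PowerSeries (LaurentSeries ℤ))ˣ) :
      PowerSeries (LaurentSeries ℤ)) := by
  cases k with
  | ofNat k => simp [seriesZPow]
  | negSucc k => simp [seriesZPow, zpow_negSucc]

theorem finprod_seriesZPow (n : ℕ+) (f : ℤ[T;T⁻¹]) :
    ∏ᶠ m : ℤ, seriesZPow (qPochhammerInf (qzMonomial n m)) (f.coeff m) =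
      (pochhammerProd n f : PowerSeries (LaurentSeries ℤ)) := by
  rw [finprod_eq_prod_of_mulSupport_subset (s := f.coeff.support), pochhammerProd, Units.coe_prod]
  · exact Finset.prod_congr rfl fun m _ => seriesZPow_val (pochhammerUnit n m) _
  · intro m hm
    rw [Finset.mem_coe, Finsupp.mem_support_iff]
    intro h0
    rw [Function.mem_mulSupport, h0] at hm
    exact hm (pow_zero _)

-- Once a finite product contains the factors 1, …, l, its coefficient of z^l is final: all other
-- factors and the remainder F l are 1 modulo z^(l+1).
open Filter in
theorem hasProd_of_sequence {W : ℕ+ → PowerSeries (LaurentSeries ℤ)}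
    {F : ℕ → PowerSeries (LaurentSeries ℤ)} (hF : ∀ k, F k = W k.succPNat * F (k + 1))
    (h1 : ∀ k, PowerSeries.X ^ (k + 1) ∣ F k - 1)
    (hW : ∀ n : ℕ+, PowerSeries.X ^ (n : ℕ) ∣ W n - 1) : HasProd W (F 0) := by
  have hprod : ∀ l, F 0 = (∏ k ∈ Finset.range l, W k.succPNat) * F l := by
    intro l
    induction l with
    | zero => simp
    | succ l ih => rw [ih, hF l, Finset.prod_range_succ, mul_assoc]
  rw [HasProd, SummationFilter.unconditional_filter,
    PowerSeries.WithPiTopology.tendsto_iff_coeff_tendsto]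
  intro l
  refine tendsto_const_nhds.congr' ?_
  filter_upwards [eventually_ge_atTop ((Finset.range l).image Nat.succPNat)] with s hs
  have hd : PowerSeries.X ^ (l + 1) ∣ (∏ n ∈ s \ (Finset.range l).image Nat.succPNat, W n) - 1 := by
    refine dvd_prod_sub_one _ fun n hn => (pow_dvd_pow _ ?_).trans (hW n)
    by_contra hlt
    refine (Finset.mem_sdiff.1 hn).2 (Finset.mem_image.2 ⟨n.natPred, ?_, n.succPNat_natPred⟩)
    rw [Finset.mem_range]
    have := n.natPred_add_one
    omega
  have := (dvd_sub (h1 l) hd).mul_left (∏ n ∈ (Finset.range l).image Nat.succPNat, W n)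
  rw [sub_sub_sub_cancel_right, mul_sub, mul_comm _ (∏ n ∈ s \ _, W n), Finset.prod_sdiff hs,
    Finset.prod_image Nat.succPNat_injective.injOn, ← hprod] at this
  exact sub_eq_zero.1 (by rw [← map_sub]; exact PowerSeries.X_pow_dvd_iff.1 this l l.lt_succ_self)

theorem theorem3 (d : ℕ) :
    -- the closed form of the Hilbert–Poincaré series, with the denominators multiplied out
    (∀ n : ℕ, PowerSeries.coeff n (hilbertSeries d) *
        ∏ i ∈ Finset.Icc 1 n, (1 - qHalfPow 2 ^ i) =
      HahnSeries.single ((1 - (d : ℤ)) * (n : ℤ) ^ 2)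
        ((((1 - (d : ℤ)) * (n : ℤ) ^ 2).negOnePow : ℤˣ) : ℤ)) ∧
    -- the Pochhammer symbols are convergent infinite products and invertible
    (∀ (n : ℕ+) (m : ℤ), Multipliable (qPochhammerFactor (qzMonomial n m)) ∧
      IsUnit (qPochhammerInf (qzMonomial n m))) ∧
    -- the factorization
    ∃ δ : ℕ+ → ℤ → ℤ,
      (∀ (n : ℕ+) (m : ℤ), δ n m ≠ 0 → (2 : ℤ) ∣ m - ((d : ℤ) - 1) * (n : ℤ)) ∧
      (∀ n : ℕ+, {m : ℤ | δ n m ≠ 0}.Finite) ∧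
      HasProd (fun n : ℕ+ => ∏ᶠ m : ℤ, seriesZPow (qPochhammerInf (qzMonomial n m)) (δ n m))
        (hilbertSeries d) := by
  refine ⟨fun n => ?_, fun n m => ⟨(hasProd_qPochhammerFactor n n.ne_zero m).multipliable,
    isUnit_of_constantCoeff_eq_one (constantCoeff_qPochhammerInf n n.ne_zero m)⟩, ?_⟩
  · rw [hilbertSeries, PowerSeries.coeff_mk, hilbertCoeff_mul_prod]
  · obtain ⟨f, F, h0, hF, h1, hpar⟩ := exists_pochhammerProd_sequence d
    refine ⟨fun n m => (f n.natPred).coeff m, fun n m hm => ?_, fun n => ?_, ?_⟩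
    · simpa using hpar n.natPred m hm
    · exact (f n.natPred).coeff.hasFiniteSupport
    · simp only [finprod_seriesZPow]
      rw [← hilbertUnit_val, ← h0]
      refine hasProd_of_sequence (F := fun k => (F k : PowerSeries (LaurentSeries ℤ)))
        (fun k => ?_) h1 fun n => ?_
      · rw [hF k, Units.val_mul, Nat.natPred_succPNat]
      · refine PowerSeries.IsOneAdd.dvd (a := ?_) ?_
        · exact ∑ m ∈ (f n.natPred).coeff.support, ((f n.natPred).coeff m : LaurentSeries ℤ) *
            PowerSeries.coeff n (qPochhammerInf (qzMonomial n m))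
        · rw [pochhammerProd, Units.coe_prod]
          exact PowerSeries.IsOneAdd.prod n.ne_zero _
            fun m _ => (isOneAdd_pochhammerUnit n m).zpow n.ne_zero _
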